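/- Let $f,g\in\mathbb{Z}[x]$ be irreducible over $\mathbb{Q}$, both of degree $n$, with roots $\alpha$ and $\beta$ and leading coefficients $f_n,g_n$. Put $\|f\|=(\sum_i f_i^2)^{1/2}$, let $S$ be a real number with $S\ge\sum_{g(\beta)=0,\ \beta\in\mathbb{C}}|\beta|$, and let $b:=nS\|f\|$. For a prime $p$ dividing none of $f_n,g_n,\operatorname{disc}(f),\operatorname{disc}(g)$ (a *good* prime) let $F_d$ be the product of the irreducible factors of $f$ of degree $d$ over $\mathbb{Q}_p$. For $h\in\mathbb{Q}[x]$ of degree $<n$ let $Tr^d_p(f,h(\alpha))=\sum_{\gamma\in\overline{\mathbb{Q}}_p,\ F_d(\gamma)=0}h(\gamma)$, and define $G_d$ and $Tr^d_p(g,\cdot)$ likewise. Let $\mathrm{Base}_i=\alpha^{i-1}/f'(\alpha)$ for $1\le i\le n$. *LLL-with-removals* with bound $b$ takes linearly independent integer row vectors $b_1,\dots,b_r$, with Gram–Schmidt vectors $b_i^*$ and coefficients $\mu_{i,j}=\langle b_i,b_j^*\rangle/\|b_j^*\|^2$, and makes moves of the following kinds, in any order, as long as one applies: (1) replace $b_i$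 by $b_i-cb_j$ where $j<i$, $|\mu_{i,j}|>\frac12$ and $c$ is the integer nearest to $\mu_{i,j}$; (2) exchange $b_{k-1}$ and $b_k$ if $\|b_k^*\|^2<(\frac34-\mu_{k,k-1}^2)\|b_{k-1}^*\|^2$; (3) remove the last vector if its Gram–Schmidt length is greater than $b$. When no move applies, the remaining vectors are LLL-reduced, the last Gram–Schmidt length (if any vector is left) is at most $b$, and they are returned. The *Pre-Processing algorithm* is as follows. 1. Start with $C$ the $(n+1)\times(n+1)$ identity matrix, $e=n+1$ (the number of rows of $C$), $p=3$ and a counter $0$. 2. (Prime search.) Replace $p$ by the next prime until $p$ is good and the number $m$ of distinct degrees of irreducible factors of $f$ modulo $p$ is not $1$. If $m=1$ has occurred for more than $25$ good primes in this search, return $C$ and stop. Once $p$ is good and $m\neq1$: if the distinct-degree factorizations of $f$ and $g$ modulo $p$ do not have the same degrees, output "there is no isomorphism" and stop. Otherwise let $d_1,\dots,d_m$ be the degrees that occur, and $a=\lceil b^{e/10}2^{e/4}\rceil$. 3. Let $T$ be an $(n+1)\times m$ integer matrix representing modulo $p^a$ the numbers $Tr_p^{d_j}(f,\mathrm{Base}_i)$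 (rows $1,\dots,n$) and $Tr_p^{d_j}(g,\beta)$ (last row). If $CT\equiv0\bmod p^a$, increase the counter by $1$; if it is then less than $10$ go to step 2, else return $C$ and stop. 4. If $CT\not\equiv0\bmod p^a$, apply LLL-with-removals with bound $b$ to the rows of $\begin{bmatrix}C&CT\\0&p^aI_m\end{bmatrix}$. 5. Write the returned rows as $[\,C\ B\,]$, where the new $C$ has $n+1$ columns and $B$ has $m$ columns. If $B\ne0$, apply LLL-with-removals with bound $b$ to the rows of $[\,C\ \ 10^{20}B\,]$ and repeat step 5. 6. If $B=0$, let $e$ be the number of rows of $C$. If $e=0$ output "there is no isomorphism" and stop. If $e=1$, write $C=[V,v]$, let $h$ be the polynomial with coefficient vector $V/v$, and stop: output $h(\alpha)g_n/f'(\alpha)$ as the only isomorphism if $v\neq0$ and this element is a root of $g$, and otherwise output "there is no isomorphism". If $e\ge2$, go to step 2. **Lemma.** The Pre-Processing algorithm always terminates. That is, for all such $f,g,S$, whatever integer representatives are chosen in $T$ and in whatever order the moves of LLL-with-removals are made, every run of the algorithm is finite (each search for a prime, each call of LLL-with-removals, the rescaling loop of step 5 and the outer loop of steps 2–6 all end),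 and no run gets stuck before it has stopped with an output. -/

import Mathlib

open Polynomial

noncomputable section

namespace NumberFieldIso

/-! ### LLL-with-removals as a rewriting process on integer rows -/

section LLL

variable {ι : Type} [Fintype ι]

/-- The rows of an integer matrix, as vectors of a Euclidean space. -/
def realRow {r : ℕ} (A : Matrix (Fin r) ι ℤ) (i : Fin r) : EuclideanSpace ℝ ι :=
  WithLp.toLp 2 fun j => (A i j : ℝ)

/-- The Gram-Schmidt vector `b_i^*` of the `i`-th row (not normalized). -/
def gsVec {r : ℕ} (A : Matrix (Fin r) ι ℤ) (i : Fin r) : EuclideanSpace ℝ ι :=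
  InnerProductSpace.gramSchmidt ℝ (realRow A) i

/-- The Gram-Schmidt coefficient `μ_{i,j} = ⟨b_i, b_j^*⟩ / ⟨b_j^*, b_j^*⟩`. -/
def gsCoeff {r : ℕ} (A : Matrix (Fin r) ι ℤ) (i j : Fin r) : ℝ :=
  inner ℝ (realRow A i) (gsVec A j) / ‖gsVec A j‖ ^ 2

/-- A list of integer row vectors: the number of rows, and the matrix. -/
abbrev Rows (ι : Type) : Type := Σ r : ℕ, Matrix (Fin r) ι ℤ

/-- The elementary moves of LLL-with-removals with bound `b`. The order in which applicable moves
are made is left open. A list of rows to which no move applies is LLL-reduced (with parameter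
`3 / 4`), and its last Gram-Schmidt vector, if there is one, has length at most `b`. -/
inductive LLLMove (b : ℝ) : Rows ι → Rows ι → Prop
  /-- Size reduction: subtract the nearest integer multiple of an earlier row. -/
  | sizeReduce {r : ℕ} (A : Matrix (Fin r) ι ℤ) (i j : Fin r) (hji : j < i)
      (hμ : 1 / 2 < |gsCoeff A i j|) :
      LLLMove b ⟨r, A⟩ ⟨r, A.updateRow i (A i - round (gsCoeff A i j) • A j)⟩
  /-- Exchange two consecutive rows at which the Lovász condition fails. -/
  | swap {r : ℕ} (A : Matrix (Fin r) ι ℤ) (i k : Fin r) (hik : (i : ℕ) + 1 = k)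
      (hL : ‖gsVec A k‖ ^ 2 < (3 / 4 - gsCoeff A k i ^ 2) * ‖gsVec A i‖ ^ 2) :
      LLLMove b ⟨r, A⟩ ⟨r, A.submatrix (Equiv.swap i k) id⟩
  /-- Remove the final row if its Gram-Schmidt length is greater than `b`. -/
  | remove {r : ℕ} (A : Matrix (Fin (r + 1)) ι ℤ) (hb : b < ‖gsVec A (Fin.last r)‖) :
      LLLMove b ⟨r + 1, A⟩ ⟨r, A.submatrix Fin.castSucc id⟩

end LLL

/-! ### Distinct-degree factors, good primes, sub-traces -/

open Classical in
/-- The product of all (monic) irreducible factors of degree `d` of a polynomial over a field. -/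
def degreeFactor {k : Type} [Field k] (f : k[X]) (d : ℕ) : k[X] :=
  ((UniqueFactorizationMonoid.normalizedFactors f).filter fun q => q.natDegree = d).prod

open Classical in
/-- The set of degrees of the irreducible factors of a polynomial over a field. -/
def factorDegrees {k : Type} [Field k] (f : k[X]) : Finset ℕ :=
  (UniqueFactorizationMonoid.normalizedFactors f).toFinset.image natDegree

/-- An integer polynomial over `ℚ`. -/
abbrev overQ (f : ℤ[X]) : ℚ[X] := f.map (Int.castRingHom ℚ)

/-- The field `ℚ(α)`, where `α` is a root of `f`. -/
abbrev RootField (f : ℤ[X]) : Type := AdjoinRoot (overQ f)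

/-- The root `α` of `f` in `ℚ(α)`. -/
abbrev rootOf (f : ℤ[X]) : RootField f := AdjoinRoot.root (overQ f)

/-- `p` is the smallest prime greater than `p₀`. -/
def IsNextPrime (p₀ p : ℕ) : Prop := IsLeast {r : ℕ | r.Prime ∧ p₀ < r} p

/-- `p` divides neither the leading coefficient nor the discriminant of `f` or `g`. -/
def IsGoodPrime (f g : ℤ[X]) (p : ℕ) : Prop :=
  ¬ (p : ℤ) ∣ f.discr ∧ ¬ (p : ℤ) ∣ f.leadingCoeff ∧
    ¬ (p : ℤ) ∣ g.discr ∧ ¬ (p : ℤ) ∣ g.leadingCoeff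

/-- The set of degrees of the irreducible factors of `f` modulo `p`. -/
def modDegrees (f : ℤ[X]) (p : ℕ) [Fact p.Prime] : Finset ℕ :=
  factorDegrees (f.map (Int.castRingHom (ZMod p)))

/-- The number `m` of distinct-degree factors of `f` modulo `p`. -/
abbrev numDegrees (f : ℤ[X]) (p : ℕ) [Fact p.Prime] : ℕ := (modDegrees f p).card

/-- The degrees `d_1 < ⋯ < d_m` belonging to the distinct-degree factors of `f` modulo `p`. -/
def degreeAt (f : ℤ[X]) (p : ℕ) [Fact p.Prime] (j : Fin (numDegrees f p)) : ℕ :=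
  (modDegrees f p).orderEmbOfFin rfl j

/-- The distinct-degree factorizations of `f` and `g` modulo `p` have the same shape. -/
def SameShape (f g : ℤ[X]) (p : ℕ) [Fact p.Prime] : Prop :=
  numDegrees f p = numDegrees g p ∧
    ∀ d : ℕ, (degreeFactor (f.map (Int.castRingHom (ZMod p))) d).natDegree =
      (degreeFactor (g.map (Int.castRingHom (ZMod p))) d).natDegree

/-- The representative `h(x) ∈ ℚ[x]` of degree `< n` of an element `h(α)` of `ℚ(α)`. -/
def representative (f : ℤ[X]) (x : RootField f) : ℚ[X] :=
  Function.surjInv AdjoinRoot.mk_surjective x % overQ f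

open Classical in
/-- The sub-trace `Tr_p^d(f, h(α)) = ∑ h(γ)`, over the roots `γ` (in an algebraic closure of `ℚ_p`)
of the product `F_d` of the irreducible factors of `f` over `ℚ_p` of degree `d`. -/
def subTrace (f : ℤ[X]) (p : ℕ) [Fact p.Prime] (d : ℕ) (x : RootField f) :
    AlgebraicClosure ℚ_[p] :=
  ∑ γ ∈ ((degreeFactor (f.map (Int.castRingHom ℚ_[p])) d).aroots
      (AlgebraicClosure ℚ_[p])).toFinset,
    aeval γ ((representative f x).map (algebraMap ℚ ℚ_[p]))

/-- The integer `t` represents the `p`-adic integer `x` modulo `p ^ a`. -/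
def Represents (p : ℕ) [Fact p.Prime] (a : ℕ) (t : ℤ) (x : AlgebraicClosure ℚ_[p]) : Prop :=
  ∃ z : ℤ_[p], x = algebraMap ℚ_[p] (AlgebraicClosure ℚ_[p]) ((t : ℚ_[p]) + (p : ℚ_[p]) ^ a * z)

/-! ### The Pre-Processing algorithm -/

/-- The norm `‖f‖`, the square root of the sum of the squares of the coefficients. -/
def coeffNorm (f : ℤ[X]) : ℝ := √(∑ i ∈ Finset.range (f.natDegree + 1), (f.coeff i : ℝ) ^ 2)

/-- The sum of the absolute values of the complex roots of `g`. -/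
def rootSum (g : ℤ[X]) : ℝ := ((g.map (Int.castRingHom ℂ)).roots.map fun β => ‖β‖).sum

/-- The bound `b = n S ‖f‖`. -/
def lengthBound (f : ℤ[X]) (S : ℝ) : ℝ := f.natDegree * S * coeffNorm f

/-- The exponent `a = ⌈b ^ (e / 10) * 2 ^ (e / 4)⌉` of the `p`-adic precision. -/
def precision (b : ℝ) (e : ℕ) : ℕ := ⌈b ^ ((e : ℝ) / 10) * (2 : ℝ) ^ ((e : ℝ) / 4)⌉₊

/-- The matrix `[C, C T; 0, P]`, where `P` is `p ^ a` times the identity. -/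
def bigMatrix {e n m : ℕ} (C : Matrix (Fin e) (Fin (n + 1)) ℤ)
    (T : Matrix (Fin (n + 1)) (Fin m) ℤ) (N : ℤ) :
    Matrix (Fin (e + m)) (Fin (n + 1) ⊕ Fin m) ℤ :=
  (Matrix.fromBlocks C (C * T) 0 (N • (1 : Matrix (Fin m) (Fin m) ℤ))).submatrix
    finSumFinEquiv.symm id

section

variable (f g : ℤ[X]) [Fact (Irreducible (overQ f))]

/-- The `i`-th element `α ^ i / f'(α)` of the rational representation basis (`i` from `0`). -/
def base (i : ℕ) : RootField f := rootOf f ^ i / aeval (rootOf f) (derivative f)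

/-- `T` is a matrix of integers representing, modulo `p ^ a`, the sub-traces
`Tr_p^{d_j}(f, Base_i)` and, in the last row, `Tr_p^{d_j}(g, β)`. -/
def IsTraceMatrix (p : ℕ) [Fact p.Prime] (a : ℕ)
    (T : Matrix (Fin (f.natDegree + 1)) (Fin (numDegrees f p)) ℤ) : Prop :=
  ∀ j : Fin (numDegrees f p),
    (∀ i : Fin f.natDegree,
      Represents p a (T i.castSucc j) (subTrace f p (degreeAt f p j) (base f i))) ∧
    Represents p a (T (Fin.last _) j) (subTrace g p (degreeAt f p j) (rootOf g))

/-- The candidate `h(α) g_n / f'(α)`, where `h` is the polynomial with coefficient vector `V / v`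
and `(V, v)` is the given row. -/
def candidate (c : Fin (f.natDegree + 1) → ℤ) : RootField f :=
  (∑ i : Fin f.natDegree,
      algebraMap ℚ (RootField f) ((c i.castSucc : ℚ) / c (Fin.last _)) * rootOf f ^ (i : ℕ)) *
    algebraMap ℚ (RootField f) g.leadingCoeff / aeval (rootOf f) (derivative f)

/-- The possible outputs. -/
inductive Output
  /-- There is no isomorphism. -/
  | noIsomorphism
  /-- The given image of `β` defines the only isomorphism. -/
  | isomorphism (x : RootField f)
  /-- The row space of a matrix with `n + 1` columns. -/
  | lattice (e : ℕ) (C : Matrix (Fin e) (Fin (f.natDegree + 1)) ℤ)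

/-- The states of the algorithm. In each of them `p` is the last prime that was tried, and `c` is
the number of previous passes in which the sub-traces gave nothing new. The variable `e` of the
algorithm always equals the number of rows of `C` when it is read, so it is not kept separately.
Variables that have no influence on the run (the pass number and the list of stored primes) are
left out. -/
inductive State
  /-- Searching for a suitable prime; `k` is the number of good primes met in this search modulo
  which all irreducible factors of `f` have the same degree. -/
  | search (p k c e : ℕ) (C : Matrix (Fin e) (Fin (f.natDegree + 1)) ℤ)
  /-- The suitable prime `p` has been found. -/
  | found (p c e : ℕ) (C : Matrix (Fin e) (Fin (f.natDegree + 1)) ℤ)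
  /-- LLL-with-removals is running, on rows that have `m` additional columns. -/
  | reduce (p c m : ℕ) (A : Rows (Fin (f.natDegree + 1) ⊕ Fin m))
  /-- LLL-with-removals has returned the rows `[C, B]`. -/
  | returned (p c m e : ℕ) (C : Matrix (Fin e) (Fin (f.natDegree + 1)) ℤ)
      (B : Matrix (Fin e) (Fin m) ℤ)
  /-- The algorithm has stopped with an output. -/
  | halt (o : Output f)

/-- The initial state: `p = 3` and `C` is the identity matrix of size `n + 1`. -/
def start : State f := .search 3 0 0 (f.natDegree + 1) 1

/-- One step of the Pre-Processing algorithm, with bound `b`, for the polynomials `f` and `g`. -/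
inductive Step (b : ℝ) : State f → State f → Prop
  /-- The next prime is not good: go on searching. -/
  | bad {p₀ k c e : ℕ} {C : Matrix (Fin e) (Fin (f.natDegree + 1)) ℤ} {p : ℕ}
      (hp : IsNextPrime p₀ p) (hbad : ¬ IsGoodPrime f g p) :
      Step b (.search p₀ k c e C) (.search p k c e C)
  /-- There is only one distinct-degree factor, and the counter allows to go on searching. -/
  | single {p₀ k c e : ℕ} {C : Matrix (Fin e) (Fin (f.natDegree + 1)) ℤ} {p : ℕ} [Fact p.Prime]
      (hp : IsNextPrime p₀ p) (hgood : IsGoodPrime f g p) (hm : numDegrees f p = 1)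
      (hk : k + 1 ≤ 25) :
      Step b (.search p₀ k c e C) (.search p (k + 1) c e C)
  /-- There is only one distinct-degree factor, and the counter exceeds `25`: return `C`. -/
  | galois {p₀ k c e : ℕ} {C : Matrix (Fin e) (Fin (f.natDegree + 1)) ℤ} {p : ℕ} [Fact p.Prime]
      (hp : IsNextPrime p₀ p) (hgood : IsGoodPrime f g p) (hm : numDegrees f p = 1)
      (hk : 25 < k + 1) :
      Step b (.search p₀ k c e C) (.halt (.lattice e C))
  /-- The factorizations of `f` and `g` modulo `p` do not match. -/
  | mismatch {p₀ k c e : ℕ} {C : Matrix (Fin e) (Fin (f.natDegree + 1)) ℤ} {p : ℕ} [Fact p.Prime]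
      (hp : IsNextPrime p₀ p) (hgood : IsGoodPrime f g p) (hm : numDegrees f p ≠ 1)
      (hs : ¬ SameShape f g p) :
      Step b (.search p₀ k c e C) (.halt .noIsomorphism)
  /-- A suitable prime has been found. -/
  | suitable {p₀ k c e : ℕ} {C : Matrix (Fin e) (Fin (f.natDegree + 1)) ℤ} {p : ℕ} [Fact p.Prime]
      (hp : IsNextPrime p₀ p) (hgood : IsGoodPrime f g p) (hm : numDegrees f p ≠ 1)
      (hs : SameShape f g p) :
      Step b (.search p₀ k c e C) (.found p c e C)
  /-- `C T ≡ 0` modulo `p ^ a`, and the counter allows another pass. -/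
  | idle {p c e : ℕ} {C : Matrix (Fin e) (Fin (f.natDegree + 1)) ℤ} [Fact p.Prime]
      (T : Matrix (Fin (f.natDegree + 1)) (Fin (numDegrees f p)) ℤ)
      (hT : IsTraceMatrix f g p (precision b e) T)
      (h0 : ∀ i j, (p : ℤ) ^ precision b e ∣ (C * T) i j) (hc : c + 1 < 10) :
      Step b (.found p c e C) (.search p 0 (c + 1) e C)
  /-- `C T ≡ 0` modulo `p ^ a`, and the counter has reached `10`: return `C`. -/
  | giveUp {p c e : ℕ} {C : Matrix (Fin e) (Fin (f.natDegree + 1)) ℤ} [Fact p.Prime]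
      (T : Matrix (Fin (f.natDegree + 1)) (Fin (numDegrees f p)) ℤ)
      (hT : IsTraceMatrix f g p (precision b e) T)
      (h0 : ∀ i j, (p : ℤ) ^ precision b e ∣ (C * T) i j) (hc : 10 ≤ c + 1) :
      Step b (.found p c e C) (.halt (.lattice e C))
  /-- `C T ≢ 0` modulo `p ^ a`: call LLL-with-removals on `[C, C T; 0, P]`. -/
  | call {p c e : ℕ} {C : Matrix (Fin e) (Fin (f.natDegree + 1)) ℤ} [Fact p.Prime]
      (T : Matrix (Fin (f.natDegree + 1)) (Fin (numDegrees f p)) ℤ)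
      (hT : IsTraceMatrix f g p (precision b e) T)
      (h0 : ¬ ∀ i j, (p : ℤ) ^ precision b e ∣ (C * T) i j) :
      Step b (.found p c e C)
        (.reduce p c (numDegrees f p)
          ⟨e + numDegrees f p, bigMatrix C T ((p : ℤ) ^ precision b e)⟩)
  /-- An elementary move of LLL-with-removals. -/
  | move {p c m : ℕ} {A A' : Rows (Fin (f.natDegree + 1) ⊕ Fin m)} (h : LLLMove b A A') :
      Step b (.reduce p c m A) (.reduce p c m A')
  /-- No move of LLL-with-removals is left: it returns. -/
  | done {p c m e : ℕ} {A : Matrix (Fin e) (Fin (f.natDegree + 1) ⊕ Fin m) ℤ}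
      (h : ¬ ∃ A', LLLMove b ⟨e, A⟩ A') :
      Step b (.reduce p c m ⟨e, A⟩) (.returned p c m e A.toCols₁ A.toCols₂)
  /-- `B ≠ 0`: rescale `B` and call LLL-with-removals again. -/
  | rescale {p c m e : ℕ} {C : Matrix (Fin e) (Fin (f.natDegree + 1)) ℤ}
      {B : Matrix (Fin e) (Fin m) ℤ} (hB : B ≠ 0) :
      Step b (.returned p c m e C B)
        (.reduce p c m ⟨e, Matrix.fromCols C ((10 ^ 20 : ℤ) • B)⟩)
  /-- `B = 0` and no row is left. -/
  | empty {p c m : ℕ} {C : Matrix (Fin 0) (Fin (f.natDegree + 1)) ℤ}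
      {B : Matrix (Fin 0) (Fin m) ℤ} (hB : B = 0) :
      Step b (.returned p c m 0 C B) (.halt .noIsomorphism)
  /-- `B = 0`, and the one row that is left gives an isomorphism. -/
  | unique {p c m : ℕ} {C : Matrix (Fin 1) (Fin (f.natDegree + 1)) ℤ}
      {B : Matrix (Fin 1) (Fin m) ℤ} (hB : B = 0)
      (h : C 0 (Fin.last _) ≠ 0 ∧ aeval (candidate f g (C 0)) g = 0) :
      Step b (.returned p c m 1 C B) (.halt (.isomorphism (candidate f g (C 0))))
  /-- `B = 0`, and the one row that is left gives no isomorphism. -/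
  | failed {p c m : ℕ} {C : Matrix (Fin 1) (Fin (f.natDegree + 1)) ℤ}
      {B : Matrix (Fin 1) (Fin m) ℤ} (hB : B = 0)
      (h : ¬ (C 0 (Fin.last _) ≠ 0 ∧ aeval (candidate f g (C 0)) g = 0)) :
      Step b (.returned p c m 1 C B) (.halt .noIsomorphism)
  /-- `B = 0` and at least two rows are left: next pass. -/
  | again {p c m e : ℕ} {C : Matrix (Fin e) (Fin (f.natDegree + 1)) ℤ}
      {B : Matrix (Fin e) (Fin m) ℤ} (hB : B = 0) (he : 2 ≤ e) :
      Step b (.returned p c m e C B) (.search p 0 c e C)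

end

end NumberFieldIso

end

/-! The loops are nested, and each has its own reason to end; all estimates hold for an arbitrary
real bound `b`. LLL: the rows stay independent, and a lexicographic triple drops at every move: the
number of rows, the product of the leading Gram determinants (positive integers), and a binary
weight of the places still to be size-reduced (`LLLMove.lllMeasure_lt`). Rescaling: after `k`
rescalings the additional entries are divisible by `10 ^ (20 * k)`, while a list to which no move
applies has entries bounded in terms of `b` and the number of columns alone
(`abs_entry_le_of_rowsIndependent_of_terminal`). So `B` vanishes eventually (`terminates_returned`).
Outer loop: the rank of the lattice spanned by `C` need not drop. But each LLL call ends with a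
strictly smaller lattice, since the new rows satisfy `x T ≡ 0` and some old row did not; and its
generators have entries bounded by a constant depending only on `n` and `b`. There are finitely many
such lattices (`latticeRank_lt`). Passes that leave `C` alone raise a counter that is never reset.
Prime search: bad primes divide a fixed nonzero integer, and the good primes that prolong a search
are counted. Progress is in doubt only when `T` must be chosen. It exists because sub-traces are
Galois-invariant and integral over `ℤ_[p]`, hence lie in `ℤ_[p]` (`exists_isTraceMatrix`). -/

noncomputable section

namespace NumberFieldIso

/-! ### Gram-Schmidt vectors under elementary changes of the family. -/

section GramSchmidt

open InnerProductSpace Submodule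

variable {E : Type*} [NormedAddCommGroup E] [InnerProductSpace ℝ E]
  {κ : Type*} [LinearOrder κ] [LocallyFiniteOrderBot κ] [WellFoundedLT κ]

theorem sub_gramSchmidt_mem_span (v : κ → E) (i : κ) :
    v i - gramSchmidt ℝ v i ∈ span ℝ (v '' Set.Iio i) := by
  rw [← span_gramSchmidt_Iio ℝ v i, sub_eq_of_eq_add' (gramSchmidt_def'' ℝ v i)]
  exact sum_mem fun _ hj => smul_mem _ _ <| subset_span
    (Set.mem_image_of_mem _ (Finset.mem_Iio.1 hj))

theorem inner_gramSchmidt_eq_zero_of_lt (v : κ → E) {i j : κ} (h : j < i) :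
    inner ℝ (v j) (gramSchmidt ℝ v i) = 0 := by
  rw [real_inner_comm]
  exact gramSchmidt_inv_triangular ℝ v h

theorem inner_eq_zero_of_mem_span {v : κ → E} {i : κ} {w : E}
    (ho : ∀ j < i, inner ℝ (v j) w = 0) {x : E} (hx : x ∈ span ℝ (v '' Set.Iio i)) :
    inner ℝ x w = 0 := by
  induction hx using span_induction with
  | mem x hx =>
    obtain ⟨j, hj, rfl⟩ := hx
    exact ho j hj
  | zero => simp
  | add x y _ _ hx hy => rw [inner_add_left, hx, hy, add_zero]
  | smul a x _ hx => rw [inner_smul_left, hx, mul_zero]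

/-- The Gram-Schmidt vector is the only vector that is orthogonal to the previous vectors and
congruent to the given one modulo their span. -/
theorem gramSchmidt_eq_of_sub_mem_span (v : κ → E) (i : κ) (w : E)
    (hw : v i - w ∈ span ℝ (v '' Set.Iio i)) (ho : ∀ j < i, inner ℝ (v j) w = 0) :
    gramSchmidt ℝ v i = w := by
  have h1 : gramSchmidt ℝ v i - w ∈ span ℝ (v '' Set.Iio i) := by
    simpa using sub_mem hw (sub_gramSchmidt_mem_span v i)
  refine sub_eq_zero.1 (inner_self_eq_zero.1 (inner_eq_zero_of_mem_span (fun j hj => ?_) h1))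
  rw [inner_sub_right, inner_gramSchmidt_eq_zero_of_lt v hj, ho j hj, sub_zero]

/-- A Gram-Schmidt vector depends only on its own vector and the span of the earlier ones. Needed to
pass to an initial block of rows. -/
theorem gramSchmidt_comp {κ' : Type*} [LinearOrder κ'] [LocallyFiniteOrderBot κ']
    [WellFoundedLT κ'] (v : κ → E) (e : κ' → κ) (i : κ')
    (he : e '' Set.Iio i = Set.Iio (e i)) :
    gramSchmidt ℝ (v ∘ e) i = gramSchmidt ℝ v (e i) := by
  refine gramSchmidt_eq_of_sub_mem_span _ _ _ ?_ fun j hj => ?_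
  · rw [Set.image_comp, he]
    exact sub_gramSchmidt_mem_span v (e i)
  · refine inner_gramSchmidt_eq_zero_of_lt v ?_
    have : e j ∈ e '' Set.Iio i := Set.mem_image_of_mem _ hj
    rwa [he] at this

theorem gramSchmidt_congr {v v' : κ → E} {i : κ} (h : ∀ j ≤ i, v' j = v j) :
    gramSchmidt ℝ v' i = gramSchmidt ℝ v i := by
  refine gramSchmidt_eq_of_sub_mem_span _ _ _ ?_ fun j hj => ?_
  · have himage : v' '' Set.Iio i = v '' Set.Iio i := Set.image_congr fun j hj => h j (le_of_lt hj)
    rw [h i le_rfl, himage]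
    exact sub_gramSchmidt_mem_span v i
  · rw [h j hj.le]
    exact inner_gramSchmidt_eq_zero_of_lt v hj

theorem gramSchmidt_update (v : κ → E) {i j : κ} (hji : j < i) (c : ℝ) :
    gramSchmidt ℝ (Function.update v i (v i - c • v j)) = gramSchmidt ℝ v := by
  set v' := Function.update v i (v i - c • v j) with hv'
  have hi : v' i = v i - c • v j := Function.update_self ..
  have hne : ∀ a, a ≠ i → v' a = v a := fun a ha => Function.update_of_ne ha ..
  -- The uniqueness criterion for the new family only asks for membership in the new spans, so one
  -- inclusion is enough.
  have hspan : ∀ l, span ℝ (v '' Set.Iio l) ≤ span ℝ (v' '' Set.Iio l) := by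
    intro l
    rw [span_le]
    rintro _ ⟨a, ha, rfl⟩
    have hmem : ∀ b < l, v' b ∈ span ℝ (v' '' Set.Iio l) := fun b hb =>
      subset_span (Set.mem_image_of_mem _ hb)
    by_cases hai : a = i
    · subst hai
      have : v a = v' a + c • v' j := by rw [hi, hne j hji.ne, sub_add_cancel]
      rw [this]
      exact add_mem (hmem a ha) (smul_mem _ _ (hmem j (hji.trans ha)))
    · rw [← hne a hai]
      exact hmem a ha
  ext1 l
  refine gramSchmidt_eq_of_sub_mem_span _ _ _ ?_ fun a ha => ?_
  · apply hspan
    by_cases hl : l = i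
    · subst hl
      rw [hi, sub_right_comm]
      exact sub_mem (sub_gramSchmidt_mem_span v l)
        (smul_mem _ _ (subset_span (Set.mem_image_of_mem _ hji)))
    · rw [hne l hl]
      exact sub_gramSchmidt_mem_span v l
  · by_cases hai : a = i
    · subst hai
      rw [hi, inner_sub_left, inner_smul_left, inner_gramSchmidt_eq_zero_of_lt v ha,
        inner_gramSchmidt_eq_zero_of_lt v (hji.trans ha), mul_zero, sub_zero]
    · rw [hne a hai]
      exact inner_gramSchmidt_eq_zero_of_lt v ha

theorem gramSchmidt_swap_of_lt (v : κ → E) {i k l : κ} (hik : i < k) (hl : l < i) :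
    gramSchmidt ℝ (v ∘ Equiv.swap i k) l = gramSchmidt ℝ v l :=
  gramSchmidt_congr fun _ hj => congrArg v <|
    Equiv.swap_apply_of_ne_of_ne (hj.trans_lt hl).ne ((hj.trans_lt hl).trans hik).ne

/-- In its new place `v k` is projected only away from the vectors before `i`, so its component
along the old Gram-Schmidt vector at `i` survives. -/
theorem gramSchmidt_swap_left (v : κ → E) {i k : κ} (hik : i ⋖ k) :
    gramSchmidt ℝ (v ∘ Equiv.swap i k) i = gramSchmidt ℝ v k +
      (inner ℝ (v k) (gramSchmidt ℝ v i) / ‖gramSchmidt ℝ v i‖ ^ 2) • gramSchmidt ℝ v i := by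
  have hne : ∀ j < i, (v ∘ Equiv.swap i k) j = v j := fun _ hj =>
    congrArg v (Equiv.swap_apply_of_ne_of_ne hj.ne (hj.trans hik.lt).ne)
  have hIio : Finset.Iio k = insert i (Finset.Iio i) := by
    ext j
    simp only [Finset.mem_Iio, Finset.mem_insert, ← le_iff_eq_or_lt]
    exact ⟨fun h => not_lt.1 fun h' => hik.2 h' h, fun h => h.trans_lt hik.lt⟩
  refine gramSchmidt_eq_of_sub_mem_span _ _ _ ?_ fun j hj => ?_
  · have h := gramSchmidt_def'' ℝ v k
    rw [hIio, Finset.sum_insert (by simp), ← add_assoc, real_inner_comm] at h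
    simp only [RCLike.ofReal_real_eq_id, id_eq] at h
    have h' : (v ∘ Equiv.swap i k) i = v k := congrArg v (Equiv.swap_apply_left i k)
    have himage : (v ∘ Equiv.swap i k) '' Set.Iio i = v '' Set.Iio i := Set.image_congr hne
    rw [h', himage, ← span_gramSchmidt_Iio ℝ v i, sub_eq_of_eq_add' h]
    exact sum_mem fun _ hj => smul_mem _ _ <| subset_span
      (Set.mem_image_of_mem _ (Finset.mem_Iio.1 hj))
  · rw [hne j hj, inner_add_right, inner_smul_right, inner_gramSchmidt_eq_zero_of_lt v hj,
      inner_gramSchmidt_eq_zero_of_lt v (hj.trans hik.lt), mul_zero, add_zero]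

theorem norm_gramSchmidt_swap_left (v : κ → E) {i k : κ} (hik : i ⋖ k) :
    ‖gramSchmidt ℝ (v ∘ Equiv.swap i k) i‖ ^ 2 = ‖gramSchmidt ℝ v k‖ ^ 2 +
      (inner ℝ (v k) (gramSchmidt ℝ v i) / ‖gramSchmidt ℝ v i‖ ^ 2) ^ 2 *
        ‖gramSchmidt ℝ v i‖ ^ 2 := by
  rw [gramSchmidt_swap_left v hik, norm_add_sq_real, inner_smul_right,
    gramSchmidt_orthogonal ℝ v hik.lt.ne', norm_smul, mul_pow, Real.norm_eq_abs, sq_abs]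
  ring

/-- The Gram matrix is `M D Mᵀ` with `M` unitriangular (the Gram-Schmidt coefficients) and `D` the
diagonal of squared lengths. -/
theorem det_gram_eq_prod_norm_gramSchmidt {r : ℕ} (v : Fin r → E) :
    (Matrix.gram ℝ v).det = ∏ i, ‖gramSchmidt ℝ v i‖ ^ 2 := by
  set c : Fin r → Fin r → ℝ := fun i j =>
    inner ℝ (gramSchmidt ℝ v j) (v i) / ‖gramSchmidt ℝ v j‖ ^ 2 with hc
  set M : Matrix (Fin r) (Fin r) ℝ :=
    Matrix.of fun i j => if j = i then 1 else if j < i then c i j else 0 with hM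
  have hv : ∀ i, v i = ∑ j, M i j • gramSchmidt ℝ v j := by
    intro i
    have h1 := gramSchmidt_def'' ℝ v i
    rw [h1, ← Finset.sum_subset (Finset.subset_univ (insert i (Finset.Iio i))),
      Finset.sum_insert (by simp)]
    · congr 1
      · simp [hM]
      · refine Finset.sum_congr rfl fun j hj => ?_
        have hj := Finset.mem_Iio.1 hj
        simp [hM, hj.ne, hj, hc]
    · intro j _ hj
      simp only [Finset.mem_insert, Finset.mem_Iio, not_or] at hj
      simp [hM, hj.1, hj.2]
  have hgram : Matrix.gram ℝ v =
      M * Matrix.diagonal (fun i => ‖gramSchmidt ℝ v i‖ ^ 2) * M.transpose := by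
    ext i j
    rw [Matrix.gram_apply, hv i, hv j, sum_inner, Matrix.mul_apply]
    refine Finset.sum_congr rfl fun a _ => ?_
    rw [inner_sum, Finset.sum_eq_single a, Matrix.mul_diagonal, inner_smul_left,
      inner_smul_right, real_inner_self_eq_norm_sq, Matrix.transpose_apply]
    · simp only [conj_trivial]
      ring
    · intro b _ hb
      rw [inner_smul_left, inner_smul_right, gramSchmidt_orthogonal ℝ v hb.symm]
      simp
    · simp
  have hdet : M.det = 1 := by
    rw [Matrix.det_of_isLowerTriangular M]
    · simp [hM]
    · intro i j hij
      have hij : i < j := hij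
      simp [hM, hij.ne', hij.not_gt]
  rw [hgram, Matrix.det_mul, Matrix.det_mul, Matrix.det_transpose, hdet, Matrix.det_diagonal]
  simp

end GramSchmidt

section LLL

open InnerProductSpace

variable {ι : Type} [Fintype ι]

/-! ### Rows, Gram determinants and independence -/

/-- The determinant of the Gram matrix of the rows. -/
def gramDet {r : ℕ} (A : Matrix (Fin r) ι ℤ) : ℤ := (A * A.transpose).det

/-- The rows of the matrix are linearly independent. -/
def RowsIndependent {r : ℕ} (A : Matrix (Fin r) ι ℤ) : Prop :=
  ∀ v : Fin r → ℤ, Matrix.vecMul v A = 0 → v = 0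

theorem gram_realRow {r : ℕ} (A : Matrix (Fin r) ι ℤ) :
    Matrix.gram ℝ (realRow A) = (A * A.transpose).map (Int.castRingHom ℝ) := by
  ext i j
  simp [realRow, PiLp.inner_apply, Matrix.mul_apply, mul_comm]

theorem gramDet_eq_prod {r : ℕ} (A : Matrix (Fin r) ι ℤ) :
    (gramDet A : ℝ) = ∏ i, ‖gsVec A i‖ ^ 2 := by
  rw [gramDet, ← eq_intCast (Int.castRingHom ℝ), RingHom.map_det, RingHom.mapMatrix_apply,
    ← gram_realRow, det_gram_eq_prod_norm_gramSchmidt]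
  rfl

/-- If `v A Aᵀ = 0`, then `v A` is orthogonal to itself, hence zero. -/
theorem rowsIndependent_iff_gramDet_ne_zero {r : ℕ} (A : Matrix (Fin r) ι ℤ) :
    RowsIndependent A ↔ gramDet A ≠ 0 := by
  rw [gramDet, Ne, ← Matrix.exists_vecMul_eq_zero_iff, not_exists]
  refine forall_congr' fun v => ?_
  rw [not_and, imp_not_comm, not_ne_iff]
  refine imp_congr_left ⟨fun h => by rw [← Matrix.vecMul_vecMul, h, Matrix.zero_vecMul], fun h => ?_⟩
  have h1 : Matrix.vecMul v A ⬝ᵥ Matrix.vecMul v A = 0 := by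
    rw [← Matrix.mulVec_transpose A v, Matrix.dotProduct_mulVec, Matrix.mulVec_transpose,
      Matrix.vecMul_vecMul, h, zero_dotProduct]
  exact dotProduct_self_eq_zero.1 h1

theorem rowsIndependent_iff_gsVec_ne_zero {r : ℕ} (A : Matrix (Fin r) ι ℤ) :
    RowsIndependent A ↔ ∀ i, gsVec A i ≠ 0 := by
  rw [rowsIndependent_iff_gramDet_ne_zero, ← Int.cast_ne_zero (α := ℝ), gramDet_eq_prod,
    Finset.prod_ne_zero_iff]
  simp

theorem RowsIndependent.card_le {r : ℕ} {A : Matrix (Fin r) ι ℤ} (hA : RowsIndependent A) :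
    r ≤ Fintype.card ι := by
  have h : LinearIndependent ℤ A.row := by
    rw [← Matrix.vecMul_injective_iff]
    intro v w hvw
    refine sub_eq_zero.1 (hA _ ?_)
    rw [Matrix.sub_vecMul]
    exact sub_eq_zero.2 hvw
  simpa using h.fintype_card_le_finrank

theorem realRow_updateRow {ι : Type} {r : ℕ} (A : Matrix (Fin r) ι ℤ) (i j : Fin r) (c : ℤ) :
    realRow (A.updateRow i (A i - c • A j)) =
      Function.update (realRow A) i (realRow A i - (c : ℝ) • realRow A j) := by
  ext l x
  by_cases hl : l = i
  · subst hl
    simp [realRow]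
  · simp [realRow, hl]

theorem gsVec_updateRow {r : ℕ} (A : Matrix (Fin r) ι ℤ) {i j : Fin r} (hji : j < i) (c : ℤ) :
    gsVec (A.updateRow i (A i - c • A j)) = gsVec A := by
  ext1 l
  rw [gsVec, realRow_updateRow, gramSchmidt_update _ hji]
  rfl

theorem gsVec_castLE {r l : ℕ} (A : Matrix (Fin r) ι ℤ) (h : l ≤ r) (i : Fin l) :
    gsVec (A.submatrix (Fin.castLE h) id) i = gsVec A (Fin.castLE h i) := by
  refine gramSchmidt_comp (realRow A) (Fin.castLE h) i ?_
  ext j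
  simp only [Set.mem_image, Set.mem_Iio]
  constructor
  · rintro ⟨x, hx, rfl⟩
    exact hx
  · intro hj
    have hj' : (j : ℕ) < i := hj
    exact ⟨⟨j, hj'.trans i.2⟩, hj, rfl⟩

theorem gramDet_submatrix_equiv {r : ℕ} (A : Matrix (Fin r) ι ℤ) (σ : Equiv.Perm (Fin r)) :
    gramDet (A.submatrix σ id) = gramDet A := by
  have : (A.submatrix σ id) * (A.submatrix σ id).transpose =
      (A * A.transpose).submatrix σ σ := rfl
  rw [gramDet, this, Matrix.det_submatrix_equiv_self, gramDet]

theorem LLLMove.rowsIndependent {b : ℝ} {A A' : Rows ι} (h : LLLMove b A A')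
    (hA : RowsIndependent A.2) : RowsIndependent A'.2 := by
  cases h with
  | sizeReduce A i j hji hμ =>
    rw [rowsIndependent_iff_gsVec_ne_zero] at hA ⊢
    simpa only [gsVec_updateRow A hji] using hA
  | swap A i k hik hL =>
    rw [rowsIndependent_iff_gramDet_ne_zero] at hA ⊢
    simpa only [gramDet_submatrix_equiv] using hA
  | remove A hb =>
    rw [rowsIndependent_iff_gsVec_ne_zero] at hA ⊢
    intro i
    exact (gsVec_castLE A (Nat.le_succ _) i).trans_ne (hA _)

/-- Stated for any submodule, so that one invariant carries both the congruences defined by `T` and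
the divisibility created by rescaling. -/
theorem LLLMove.row_mem {b : ℝ} {A A' : Rows ι} (h : LLLMove b A A')
    {M : Submodule ℤ (ι → ℤ)} (hA : ∀ i, A.2 i ∈ M) : ∀ i, A'.2 i ∈ M := by
  cases h with
  | sizeReduce A i j hji hμ =>
    intro l
    by_cases hl : l = i
    · simp only [hl, Matrix.updateRow_self]
      exact sub_mem (hA i) (M.smul_mem _ (hA j))
    · simp only [Matrix.updateRow_ne hl]
      exact hA l
  | swap A i k hik hL => exact fun l => hA _
  | remove A hb => exact fun l => hA _

/-! ### Termination of LLL-with-removals -/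

/-- The rows up to the given one. -/
def leadingRows {r : ℕ} (A : Matrix (Fin r) ι ℤ) (l : Fin r) : Matrix (Fin (l + 1)) ι ℤ :=
  A.submatrix (Fin.castLE l.2) id

/-- The product of the leading Gram determinants. -/
def lllPotential {r : ℕ} (A : Matrix (Fin r) ι ℤ) : ℕ :=
  ∏ l, (gramDet (leadingRows A l)).natAbs

open Classical in
/-- The positions in a row at which a size reduction is possible. -/
def unreduced {r : ℕ} (A : Matrix (Fin r) ι ℤ) (i : Fin r) : Finset (Fin r) :=
  {j | j < i ∧ 1 / 2 < |gsCoeff A i j|}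

/-- The positions at which a size reduction is possible, weighted by powers of two. -/
def sizeWeight {r : ℕ} (A : Matrix (Fin r) ι ℤ) : ℕ :=
  ∑ i, ∑ j ∈ unreduced A i, 2 ^ (j : ℕ)

theorem gramDet_leadingRows {r : ℕ} (A : Matrix (Fin r) ι ℤ) (l : Fin r) :
    (gramDet (leadingRows A l) : ℝ) =
      (∏ j : Fin l, ‖gsVec A (Fin.castLE l.2.le j)‖ ^ 2) * ‖gsVec A l‖ ^ 2 := by
  rw [gramDet_eq_prod, Fin.prod_univ_castSucc]
  simp only [leadingRows, gsVec_castLE]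
  rfl

theorem gramDet_leadingRows_pos {r : ℕ} {A : Matrix (Fin r) ι ℤ} (hA : RowsIndependent A)
    (l : Fin r) : 0 < gramDet (leadingRows A l) := by
  rw [rowsIndependent_iff_gsVec_ne_zero] at hA
  rw [← Int.cast_pos (R := ℝ), gramDet_leadingRows]
  have h : ∀ j, 0 < ‖gsVec A j‖ ^ 2 := fun j => pow_pos (norm_pos_iff.2 (hA j)) 2
  exact mul_pos (Finset.prod_pos fun _ _ => h _) (h l)

theorem gramDet_leadingRows_congr {r : ℕ} {A A' : Matrix (Fin r) ι ℤ} {l : Fin r}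
    (h : ∀ j ≤ l, gsVec A' j = gsVec A j) :
    gramDet (leadingRows A' l) = gramDet (leadingRows A l) := by
  rw [← Int.cast_inj (α := ℝ), gramDet_leadingRows, gramDet_leadingRows, h l le_rfl]
  congr 1
  exact Finset.prod_congr rfl fun j _ => by rw [h _ (Fin.le_def.2 j.2.le)]

theorem lllPotential_updateRow {r : ℕ} (A : Matrix (Fin r) ι ℤ) {i j : Fin r} (hji : j < i)
    (c : ℤ) : lllPotential (A.updateRow i (A i - c • A j)) = lllPotential A :=
  Finset.prod_congr rfl fun l _ => congrArg Int.natAbs <|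
    gramDet_leadingRows_congr fun _ _ => by rw [gsVec_updateRow A hji]

theorem gramDet_leadingRows_swap_of_le {r : ℕ} (A : Matrix (Fin r) ι ℤ) {i k l : Fin r}
    (hi : i ≤ l) (hk : k ≤ l) :
    gramDet (leadingRows (A.submatrix (Equiv.swap i k) id) l) = gramDet (leadingRows A l) := by
  have hi' : (i : ℕ) < l + 1 := Nat.lt_succ_of_le hi
  have hk' : (k : ℕ) < l + 1 := Nat.lt_succ_of_le hk
  rw [← gramDet_submatrix_equiv (leadingRows A l) (Equiv.swap ⟨i, hi'⟩ ⟨k, hk'⟩)]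
  congr 1
  ext x y
  simp only [leadingRows, Matrix.submatrix_apply, id_eq]
  congr 1
  exact (Function.Injective.map_swap (Fin.castLE_injective l.2) ⟨i, hi'⟩ ⟨k, hk'⟩ x).symm

/-- Only the leading determinant at `i` changes: earlier blocks are untouched, and blocks reaching
`k` are merely permuted. At `i` the squared length becomes `‖b_k^*‖² + μ² ‖b_i^*‖²`, which the
failing Lovász condition makes smaller than `‖b_i^*‖²`. -/
theorem lllPotential_swap {r : ℕ} {A : Matrix (Fin r) ι ℤ} (hA : RowsIndependent A)
    {i k : Fin r} (hik : (i : ℕ) + 1 = k)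
    (hL : ‖gsVec A k‖ ^ 2 < (3 / 4 - gsCoeff A k i ^ 2) * ‖gsVec A i‖ ^ 2) :
    lllPotential (A.submatrix (Equiv.swap i k) id) < lllPotential A := by
  have hA' : RowsIndependent (A.submatrix (Equiv.swap i k) id) :=
    (LLLMove.swap (b := 0) A i k hik hL).rowsIndependent hA
  have hlt : i < k := Fin.lt_def.2 (by omega)
  have hcov : i ⋖ k := ⟨hlt, fun c h1 h2 => by
    have h1 := Fin.lt_def.1 h1
    have h2 := Fin.lt_def.1 h2
    omega⟩
  have hsame : ∀ l < i, gsVec (A.submatrix (Equiv.swap i k) id) l = gsVec A l := fun l hl =>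
    gramSchmidt_swap_of_lt (realRow A) hlt hl
  have hi : gramDet (leadingRows (A.submatrix (Equiv.swap i k) id) i) <
      gramDet (leadingRows A i) := by
    have h0 := rowsIndependent_iff_gsVec_ne_zero A |>.1 hA
    have hpos : ∀ j, 0 < ‖gsVec A j‖ ^ 2 := fun j => pow_pos (norm_pos_iff.2 (h0 j)) 2
    have hnew : ‖gsVec (A.submatrix (Equiv.swap i k) id) i‖ ^ 2 < ‖gsVec A i‖ ^ 2 := by
      have h1 : ‖gsVec (A.submatrix (Equiv.swap i k) id) i‖ ^ 2 =
          ‖gsVec A k‖ ^ 2 + gsCoeff A k i ^ 2 * ‖gsVec A i‖ ^ 2 :=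
        norm_gramSchmidt_swap_left (realRow A) hcov
      have := hpos i
      rw [h1]
      linarith
    rw [← Int.cast_lt (R := ℝ), gramDet_leadingRows, gramDet_leadingRows]
    rw [Finset.prod_congr rfl fun (j : Fin i) _ => by rw [hsame _ (Fin.lt_def.2 j.2)]]
    exact mul_lt_mul_of_pos_left hnew (Finset.prod_pos fun _ _ => hpos _)
  refine Finset.prod_lt_prod (fun l _ => Int.natAbs_pos.2 (gramDet_leadingRows_pos hA' l).ne')
    (fun l _ => ?_) ⟨i, Finset.mem_univ i, ?_⟩
  · rcases lt_trichotomy l i with hl | rfl | hl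
    · rw [gramDet_leadingRows_congr fun j hj => hsame j (hj.trans_lt hl)]
    · exact (Int.natAbs_lt_natAbs_of_nonneg_of_lt (gramDet_leadingRows_pos hA' l).le hi).le
    · rw [gramDet_leadingRows_swap_of_le A hl.le (hcov.ge_of_gt hl)]
  · exact Int.natAbs_lt_natAbs_of_nonneg_of_lt (gramDet_leadingRows_pos hA' i).le hi

/-- Comparison of binary numbers: losing the digit at `j` outweighs any gain in lower digits. -/
theorem sum_two_pow_lt_of_max_removed {r : ℕ} {s t : Finset (Fin r)} {j : Fin r} (hs : j ∈ s)
    (ht : j ∉ t) (h : ∀ l, j < l → l ∈ t → l ∈ s) :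
    ∑ l ∈ t, 2 ^ (l : ℕ) < ∑ l ∈ s, 2 ^ (l : ℕ) := by
  have hlow : ∑ l ∈ t with l < j, 2 ^ (l : ℕ) < 2 ^ (j : ℕ) := by
    calc ∑ l ∈ t with l < j, 2 ^ (l : ℕ)
        = ∑ x ∈ (t.filter (· < j)).map Fin.valEmbedding, 2 ^ x := by rw [Finset.sum_map]; rfl
      _ ≤ ∑ x ∈ Finset.range j, 2 ^ x := by
        refine Finset.sum_le_sum_of_subset fun x hx => ?_
        obtain ⟨l, hl, rfl⟩ := Finset.mem_map.1 hx
        exact Finset.mem_range.2 (Finset.mem_filter.1 hl).2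
      _ < 2 ^ (j : ℕ) := Nat.geomSum_lt le_rfl fun x hx => Finset.mem_range.1 hx
  calc ∑ l ∈ t, 2 ^ (l : ℕ)
      = ∑ l ∈ t with l < j, 2 ^ (l : ℕ) + ∑ l ∈ t with ¬ l < j, 2 ^ (l : ℕ) :=
        (Finset.sum_filter_add_sum_filter_not ..).symm
    _ < 2 ^ (j : ℕ) + ∑ l ∈ t with ¬ l < j, 2 ^ (l : ℕ) := Nat.add_lt_add_right hlow _
    _ ≤ 2 ^ (j : ℕ) + ∑ l ∈ s.erase j, 2 ^ (l : ℕ) := by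
        refine Nat.add_le_add_left (Finset.sum_le_sum_of_subset fun l hl => ?_) _
        obtain ⟨hlt, hlj⟩ := Finset.mem_filter.1 hl
        have hne : l ≠ j := fun h' => ht (h' ▸ hlt)
        exact Finset.mem_erase.2 ⟨hne, h l (lt_of_le_of_ne (not_lt.1 hlj) hne.symm) hlt⟩
    _ = ∑ l ∈ s, 2 ^ (l : ℕ) := Finset.add_sum_erase s (fun l : Fin r => 2 ^ (l : ℕ)) hs

theorem gsCoeff_self {r : ℕ} {A : Matrix (Fin r) ι ℤ} {j : Fin r} (h : gsVec A j ≠ 0) :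
    gsCoeff A j j = 1 := by
  have h1 : inner ℝ (realRow A j - gsVec A j) (gsVec A j) = (0 : ℝ) :=
    inner_eq_zero_of_mem_span (fun _ hl => inner_gramSchmidt_eq_zero_of_lt _ hl)
      (sub_gramSchmidt_mem_span (realRow A) j)
  rw [inner_sub_left, sub_eq_zero] at h1
  rw [gsCoeff, h1, real_inner_self_eq_norm_sq, div_self (pow_ne_zero 2 (norm_ne_zero_iff.2 h))]

theorem gsCoeff_eq_zero_of_lt {r : ℕ} (A : Matrix (Fin r) ι ℤ) {i j : Fin r} (h : i < j) :
    gsCoeff A i j = 0 := by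
  rw [gsCoeff, gsVec, inner_gramSchmidt_eq_zero_of_lt _ h, zero_div]

theorem gsCoeff_updateRow_self {r : ℕ} (A : Matrix (Fin r) ι ℤ) {i j : Fin r} (hji : j < i)
    (c : ℤ) (l : Fin r) :
    gsCoeff (A.updateRow i (A i - c • A j)) i l = gsCoeff A i l - c * gsCoeff A j l := by
  rw [gsCoeff, gsVec_updateRow A hji, realRow_updateRow, Function.update_self, inner_sub_left,
    inner_smul_left, sub_div, mul_div_assoc]
  rfl

theorem gsCoeff_updateRow_ne {r : ℕ} (A : Matrix (Fin r) ι ℤ) {i j : Fin r} (hji : j < i)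
    (c : ℤ) {i' : Fin r} (hi' : i' ≠ i) (l : Fin r) :
    gsCoeff (A.updateRow i (A i - c • A j)) i' l = gsCoeff A i' l := by
  rw [gsCoeff, gsVec_updateRow A hji, realRow_updateRow, Function.update_of_ne hi', gsCoeff]

/-- Subtracting a multiple of row `j` repairs position `j` of row `i` and keeps the positions after
`j`, but may spoil those before it; hence the weights by powers of two. -/
theorem sizeWeight_sizeReduce {r : ℕ} {A : Matrix (Fin r) ι ℤ} (hA : RowsIndependent A)
    {i j : Fin r} (hji : j < i) (hμ : 1 / 2 < |gsCoeff A i j|) :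
    sizeWeight (A.updateRow i (A i - round (gsCoeff A i j) • A j)) < sizeWeight A := by
  set c := round (gsCoeff A i j) with hc
  have hcoeff := gsCoeff_updateRow_self A hji c
  have hrow : ∑ l ∈ unreduced (A.updateRow i (A i - c • A j)) i, 2 ^ (l : ℕ) <
      ∑ l ∈ unreduced A i, 2 ^ (l : ℕ) := by
    refine sum_two_pow_lt_of_max_removed (j := j) ?_ ?_ fun l hl => ?_
    · simpa [unreduced] using And.intro hji hμ
    · simp only [unreduced, Finset.mem_filter_univ, not_and, not_lt]
      intro _
      rw [hcoeff, gsCoeff_self ((rowsIndependent_iff_gsVec_ne_zero A).1 hA j), mul_one]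
      exact abs_sub_round _
    · simp only [unreduced, Finset.mem_filter_univ]
      rw [hcoeff, gsCoeff_eq_zero_of_lt A hl, mul_zero, sub_zero]
      exact id
  refine Finset.sum_lt_sum (fun i' _ => ?_) ⟨i, Finset.mem_univ i, hrow⟩
  by_cases hi' : i' = i
  · rw [hi']
    exact hrow.le
  · simp only [unreduced, gsCoeff_updateRow_ne A hji c hi', le_refl]

/-- The termination measure of LLL-with-removals. -/
def lllMeasure (A : Rows ι) : ℕ ×ₗ ℕ ×ₗ ℕ :=
  toLex (A.1, toLex (lllPotential A.2, sizeWeight A.2))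

theorem LLLMove.lllMeasure_lt {b : ℝ} {A A' : Rows ι} (h : LLLMove b A A')
    (hA : RowsIndependent A.2) : lllMeasure A' < lllMeasure A := by
  cases h with
  | sizeReduce A i j hji hμ =>
    refine Prod.Lex.toLex_lt_toLex.2 (Or.inr ⟨rfl, Prod.Lex.toLex_lt_toLex.2 (Or.inr ⟨?_, ?_⟩)⟩)
    · exact lllPotential_updateRow A hji _
    · exact sizeWeight_sizeReduce hA hji hμ
  | swap A i k hik hL =>
    exact Prod.Lex.toLex_lt_toLex.2 (Or.inr ⟨rfl, Prod.Lex.toLex_lt_toLex.2 <|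
      Or.inl (lllPotential_swap hA hik hL)⟩)
  | remove A hb => exact Prod.Lex.toLex_lt_toLex.2 (Or.inl (Nat.lt_succ_self _))

theorem acc_lllMove (b : ℝ) (A : Rows ι) (hA : RowsIndependent A.2) :
    Acc (fun A' A => LLLMove b A A') A := by
  induction h : lllMeasure A using WellFoundedLT.induction generalizing A with
  | ind x ih =>
    subst h
    exact ⟨_, fun A' h => ih _ (h.lllMeasure_lt hA) A' (h.rowsIndependent hA) rfl⟩

/-! ### Lists of rows to which no move applies -/

/-- The last length is at most `b`; the Lovász condition with `|μ| ≤ 1/2` gives `‖b_i^*‖² ≤ 2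
‖b_{i+1}^*‖²`, so the bound propagates backwards. The absolute value of `b` avoids a sign
hypothesis. -/
theorem norm_gsVec_le_of_terminal {b : ℝ} {r : ℕ} {A : Matrix (Fin r) ι ℤ}
    (h : ¬ ∃ A', LLLMove b ⟨r, A⟩ A') (i : Fin r) : ‖gsVec A i‖ ≤ 2 ^ r * |b| := by
  have hμ : ∀ i j, j < i → |gsCoeff A i j| ≤ 1 / 2 := fun i j hji =>
    not_lt.1 fun hμ => h ⟨_, .sizeReduce A i j hji hμ⟩
  -- Here `t` is the number of rows after row `i`.
  have key : ∀ t : ℕ, ∀ i : Fin r, (i : ℕ) + t + 1 = r → ‖gsVec A i‖ ^ 2 ≤ 2 ^ t * b ^ 2 := by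
    intro t
    induction t with
    | zero =>
      intro i hi
      obtain ⟨s, rfl⟩ : ∃ s, r = s + 1 := ⟨i, hi.symm⟩
      have hlast : i = Fin.last s := Fin.ext (by simpa using hi)
      have hb : ‖gsVec A (Fin.last s)‖ ≤ b := not_lt.1 fun hb => h ⟨_, .remove A hb⟩
      rw [hlast, pow_zero, one_mul]
      exact pow_le_pow_left₀ (norm_nonneg _) hb 2
    | succ t ih =>
      intro i hi
      have hk : (i : ℕ) + 1 < r := by omega
      have h1 := ih ⟨i + 1, hk⟩ (by simp only; omega)
      have h2 := not_lt.1 fun hL => h ⟨_, .swap A i ⟨i + 1, hk⟩ rfl hL⟩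
      have h3 : gsCoeff A ⟨i + 1, hk⟩ i ^ 2 ≤ 1 / 4 := by
        have := hμ ⟨i + 1, hk⟩ i (Fin.lt_def.2 (Nat.lt_succ_self _))
        rw [← sq_abs]
        calc |gsCoeff A ⟨i + 1, hk⟩ i| ^ 2 ≤ (1 / 2) ^ 2 := pow_le_pow_left₀ (abs_nonneg _) this 2
          _ = 1 / 4 := by norm_num
      have h4 : 1 / 2 * ‖gsVec A i‖ ^ 2 ≤ (3 / 4 - gsCoeff A ⟨i + 1, hk⟩ i ^ 2) * ‖gsVec A i‖ ^ 2 :=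
        mul_le_mul_of_nonneg_right (by linarith) (sq_nonneg _)
      rw [pow_succ 2 t]
      linarith
  have h1 := key (r - 1 - i) i (by omega)
  refine abs_le_of_sq_le_sq' ?_ (by positivity) |>.2
  calc ‖gsVec A i‖ ^ 2 ≤ 2 ^ (r - 1 - i) * b ^ 2 := h1
    _ ≤ 2 ^ (r * 2) * b ^ 2 := by
      gcongr
      · norm_num
      · omega
    _ = (2 ^ r * |b|) ^ 2 := by rw [mul_pow, sq_abs, pow_mul]

/-- By size reduction, a row is its Gram-Schmidt vector plus earlier ones with coefficients at most
`1/2`, so its norm is at most the sum of all Gram-Schmidt lengths. -/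
theorem abs_entry_le_of_terminal {b : ℝ} {r : ℕ} {A : Matrix (Fin r) ι ℤ}
    (h : ¬ ∃ A', LLLMove b ⟨r, A⟩ A') (i : Fin r) (x : ι) :
    (|A i x| : ℝ) ≤ r * (2 ^ r * |b|) := by
  have hμ : ∀ j, j < i → |gsCoeff A i j| ≤ 1 / 2 := fun j hji =>
    not_lt.1 fun hμ => h ⟨_, .sizeReduce A i j hji hμ⟩
  have h1 : |(A i x : ℝ)| ≤ ‖realRow A i‖ := PiLp.norm_apply_le (realRow A i) x
  refine h1.trans ?_
  have h2 := gramSchmidt_def'' ℝ (realRow A) i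
  rw [h2]
  calc _ ≤ ‖gsVec A i‖ + ∑ j ∈ Finset.Iio i, ‖gsVec A j‖ := by
        refine (norm_add_le _ _).trans (add_le_add le_rfl ((norm_sum_le _ _).trans ?_))
        refine Finset.sum_le_sum fun j hj => ?_
        rw [norm_smul, real_inner_comm]
        refine (mul_le_mul_of_nonneg_right ((hμ j (Finset.mem_Iio.1 hj)).trans ?_)
          (norm_nonneg _)).trans (one_mul _).le
        norm_num
    _ = ∑ j ∈ Finset.Iic i, ‖gsVec A j‖ := by
        rw [← Finset.Iio_insert, Finset.sum_insert (by simp)]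
    _ ≤ ∑ j, ‖gsVec A j‖ :=
        Finset.sum_le_sum_of_subset_of_nonneg (Finset.subset_univ _) fun _ _ _ => norm_nonneg _
    _ ≤ ∑ _j : Fin r, 2 ^ r * |b| := Finset.sum_le_sum fun j _ => norm_gsVec_le_of_terminal h j
    _ = r * (2 ^ r * |b|) := by simp

theorem abs_entry_le_of_rowsIndependent_of_terminal {b : ℝ} {r N : ℕ} {A : Matrix (Fin r) ι ℤ}
    (hA : RowsIndependent A) (h : ¬ ∃ A', LLLMove b ⟨r, A⟩ A') (hN : Fintype.card ι ≤ N)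
    (i : Fin r) (x : ι) : (|A i x| : ℝ) ≤ N * (2 ^ N * |b|) := by
  have hr : r ≤ N := hA.card_le.trans hN
  refine (abs_entry_le_of_terminal h i x).trans ?_
  gcongr
  norm_num

end LLL

/-! ### The lattices behind the calls of LLL-with-removals -/

section Lattice

variable {q m : ℕ}

/-- The lattice spanned by the rows. -/
def rowLattice {e : ℕ} (C : Matrix (Fin e) (Fin q) ℤ) : Submodule ℤ (Fin q → ℤ) :=
  Submodule.span ℤ (Set.range C.row)

/-- The vectors `(x, z)` with `x` in `L` and `z ≡ x T` modulo `N`. -/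
def traceLattice (L : Submodule ℤ (Fin q → ℤ)) (T : Matrix (Fin q) (Fin m) ℤ) (N : ℤ) :
    Submodule ℤ (Fin q ⊕ Fin m → ℤ) where
  carrier := {u | u ∘ Sum.inl ∈ L ∧
    ∀ j, N ∣ u (Sum.inr j) - Matrix.vecMul (u ∘ Sum.inl) T j}
  add_mem' := by
    rintro u v ⟨hu, hu'⟩ ⟨hv, hv'⟩
    refine ⟨L.add_mem hu hv, fun j => ?_⟩
    have h : (u + v) ∘ Sum.inl = u ∘ Sum.inl + v ∘ Sum.inl := rfl
    rw [h, Matrix.add_vecMul, Pi.add_apply, Pi.add_apply, add_sub_add_comm]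
    exact dvd_add (hu' j) (hv' j)
  zero_mem' := by
    refine ⟨L.zero_mem, fun j => ?_⟩
    have h : (0 : Fin q ⊕ Fin m → ℤ) ∘ Sum.inl = 0 := rfl
    simp [h]
  smul_mem' := by
    rintro c u ⟨hu, hu'⟩
    refine ⟨L.smul_mem c hu, fun j => ?_⟩
    have h : (c • u) ∘ Sum.inl = c • (u ∘ Sum.inl) := rfl
    rw [h, Matrix.smul_vecMul, Pi.smul_apply, Pi.smul_apply, ← smul_sub]
    exact Dvd.dvd.mul_left (hu' j) c

/-- Multiplication of the additional columns by `t`. -/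
def scaleRight (q m : ℕ) (t : ℤ) : (Fin q ⊕ Fin m → ℤ) →ₗ[ℤ] (Fin q ⊕ Fin m → ℤ) where
  toFun u := Sum.elim (u ∘ Sum.inl) (t • (u ∘ Sum.inr))
  map_add' u v := by ext (x | x) <;> simp [mul_add]
  map_smul' c u := by ext (x | x) <;> simp [mul_left_comm]

theorem scaleRight_one (u : Fin q ⊕ Fin m → ℤ) : scaleRight q m 1 u = u := by
  ext (x | x) <;> simp [scaleRight]

theorem scaleRight_scaleRight (s t : ℤ) (u : Fin q ⊕ Fin m → ℤ) :
    scaleRight q m s (scaleRight q m t u) = scaleRight q m (s * t) u := by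
  ext (x | x) <;> simp [scaleRight, mul_assoc]

theorem vecMul_fromCols {e : ℕ} (v : Fin e → ℤ) (C : Matrix (Fin e) (Fin q) ℤ)
    (B : Matrix (Fin e) (Fin m) ℤ) :
    Matrix.vecMul v (Matrix.fromCols C B) = Sum.elim (Matrix.vecMul v C) (Matrix.vecMul v B) :=
  Matrix.vecMul_fromCols C B v

theorem rowsIndependent_rescale {e : ℕ} {A : Matrix (Fin e) (Fin q ⊕ Fin m) ℤ}
    (hA : RowsIndependent A) {t : ℤ} (ht : t ≠ 0) :
    RowsIndependent (Matrix.fromCols A.toCols₁ (t • A.toCols₂)) := by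
  intro v hv
  refine hA v ?_
  rw [← Matrix.fromCols_toCols A, vecMul_fromCols]
  rw [vecMul_fromCols] at hv
  ext (x | x)
  · exact congrFun hv (Sum.inl x)
  · have := congrFun hv (Sum.inr x)
    rw [Sum.elim_inr, Matrix.vecMul_smul, Pi.smul_apply, smul_eq_mul] at this
    exact (mul_eq_zero.1 this).resolve_left ht

theorem rowsIndependent_toCols₁ {e : ℕ} {A : Matrix (Fin e) (Fin q ⊕ Fin m) ℤ}
    (hA : RowsIndependent A) (hB : A.toCols₂ = 0) : RowsIndependent A.toCols₁ := by
  intro v hv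
  refine hA v ?_
  rw [← Matrix.fromCols_toCols A, vecMul_fromCols, hv, hB, Matrix.vecMul_zero]
  ext (x | x) <;> rfl

theorem rescale_row {e : ℕ} (A : Matrix (Fin e) (Fin q ⊕ Fin m) ℤ) (t : ℤ) (i : Fin e) :
    Matrix.fromCols A.toCols₁ (t • A.toCols₂) i = scaleRight q m t (A i) := by
  ext (x | x) <;> rfl

theorem rowsIndependent_one (q : ℕ) :
    RowsIndependent (1 : Matrix (Fin q) (Fin q) ℤ) := fun v hv => by
  rwa [Matrix.vecMul_one] at hv

variable {n : ℕ}

theorem bigMatrix_eq {e : ℕ} (C : Matrix (Fin e) (Fin (n + 1)) ℤ)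
    (T : Matrix (Fin (n + 1)) (Fin m) ℤ) (N : ℤ) (i : Fin (e + m)) :
    bigMatrix C T N i =
      Matrix.fromBlocks C (C * T) 0 (N • (1 : Matrix (Fin m) (Fin m) ℤ)) (finSumFinEquiv.symm i) :=
  rfl

/-- The matrix is block triangular: independence of `C` kills the first block of coefficients, then
`N ≠ 0` kills the second. -/
theorem rowsIndependent_bigMatrix {e : ℕ} {C : Matrix (Fin e) (Fin (n + 1)) ℤ}
    (hC : RowsIndependent C) (T : Matrix (Fin (n + 1)) (Fin m) ℤ) {N : ℤ} (hN : N ≠ 0) :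
    RowsIndependent (bigMatrix C T N) := by
  intro v hv
  have h : Matrix.vecMul (v ∘ finSumFinEquiv)
      (Matrix.fromBlocks C (C * T) 0 (N • (1 : Matrix (Fin m) (Fin m) ℤ))) = 0 := by
    rw [← hv]
    ext x
    simp only [Matrix.vecMul, dotProduct, bigMatrix_eq]
    exact Fintype.sum_equiv finSumFinEquiv _ _ fun y => by simp
  rw [Matrix.vecMul_fromBlocks] at h
  have h1 : v ∘ finSumFinEquiv ∘ Sum.inl = 0 := by
    refine hC _ (funext fun x => ?_)
    simpa [← Function.comp_assoc] using congrFun h (Sum.inl x)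
  have h2 : v ∘ finSumFinEquiv ∘ Sum.inr = 0 := by
    ext x
    have := congrFun h (Sum.inr x)
    rw [Sum.elim_inr, Function.comp_assoc, h1, Matrix.zero_vecMul, zero_add, Matrix.vecMul_smul,
      Matrix.vecMul_one] at this
    exact (mul_eq_zero.1 this).resolve_left hN
  ext x
  obtain ⟨x, rfl⟩ := finSumFinEquiv.surjective x
  rcases x with x | x
  · exact congrFun h1 x
  · exact congrFun h2 x

theorem bigMatrix_row_mem {e : ℕ} (C : Matrix (Fin e) (Fin (n + 1)) ℤ)
    (T : Matrix (Fin (n + 1)) (Fin m) ℤ) (N : ℤ) (i : Fin (e + m)) :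
    bigMatrix C T N i ∈ traceLattice (rowLattice C) T N := by
  rw [bigMatrix_eq]
  rcases finSumFinEquiv.symm i with y | y
  · refine ⟨Submodule.subset_span ⟨y, rfl⟩, fun j => ?_⟩
    have : Matrix.fromBlocks C (C * T) 0 (N • (1 : Matrix (Fin m) (Fin m) ℤ)) (Sum.inl y)
        (Sum.inr j) = Matrix.vecMul (C y) T j := rfl
    rw [this]
    exact (sub_self (Matrix.vecMul (C y) T j)).symm ▸ dvd_zero N
  · refine ⟨Submodule.zero_mem _, fun j => ?_⟩
    have h : Matrix.fromBlocks C (C * T) 0 (N • (1 : Matrix (Fin m) (Fin m) ℤ)) (Sum.inr y) ∘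
        Sum.inl = 0 := rfl
    rw [h, Matrix.zero_vecMul, Pi.zero_apply, sub_zero]
    exact Dvd.intro _ rfl

/-- Rows of a scaled trace lattice without additional components span a proper sublattice. -/
theorem rowLattice_toCols₁_lt {e e' : ℕ} {C : Matrix (Fin e) (Fin q) ℤ}
    {T : Matrix (Fin q) (Fin m) ℤ} {N t : ℤ} (ht : t ≠ 0) (h0 : ¬ ∀ i j, N ∣ (C * T) i j)
    {A : Matrix (Fin e') (Fin q ⊕ Fin m) ℤ}
    (hA : ∀ i, A i ∈ (traceLattice (rowLattice C) T N).map (scaleRight q m t))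
    (hB : A.toCols₂ = 0) : rowLattice A.toCols₁ < rowLattice C := by
  have hmem : ∀ x ∈ rowLattice A.toCols₁,
      x ∈ rowLattice C ∧ ∀ j, N ∣ Matrix.vecMul x T j := by
    intro x hx
    induction hx using Submodule.span_induction with
    | mem x hx =>
      obtain ⟨i, rfl⟩ := hx
      obtain ⟨u, ⟨hu, hu'⟩, hui⟩ := hA i
      have h1 : A.toCols₁.row i = u ∘ Sum.inl := funext fun x => (congrFun hui (Sum.inl x)).symm
      -- Since `t ≠ 0`, the additional part already vanished before scaling, so the congruence
      -- becomes `x T ≡ 0`.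
      have h2 : ∀ j, u (Sum.inr j) = 0 := fun j => by
        have h3 : t * u (Sum.inr j) = A.toCols₂ i j := congrFun hui (Sum.inr j)
        rw [hB] at h3
        exact (mul_eq_zero.1 h3).resolve_left ht
      rw [h1]
      refine ⟨hu, fun j => ?_⟩
      have := hu' j
      rwa [h2, zero_sub, dvd_neg] at this
    | zero => exact ⟨zero_mem _, fun j => by simp⟩
    | add x y _ _ hx hy =>
      refine ⟨add_mem hx.1 hy.1, fun j => ?_⟩
      rw [Matrix.add_vecMul]
      exact dvd_add (hx.2 j) (hy.2 j)
    | smul a x _ hx =>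
      refine ⟨Submodule.smul_mem _ _ hx.1, fun j => ?_⟩
      rw [Matrix.smul_vecMul]
      exact Dvd.dvd.mul_left (hx.2 j) a
  -- Equality would place every row of `C` among these vectors and give `C T ≡ 0`.
  refine lt_of_le_of_ne (fun x hx => (hmem x hx).1) fun heq => h0 fun i j => ?_
  exact (hmem (C i) (heq ▸ Submodule.subset_span ⟨i, rfl⟩)).2 j

/-- The lattices spanned by integer vectors with entries of absolute value at most `R`. -/
def boundedLattices (q R : ℕ) : Set (Submodule ℤ (Fin q → ℤ)) :=
  Submodule.span ℤ '' {X | X ⊆ Set.Icc (fun _ => -(R : ℤ)) (fun _ => (R : ℤ))}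

theorem finite_boundedLattices (q R : ℕ) : (boundedLattices q R).Finite :=
  (Set.finite_Icc _ _).finite_subsets.image _

theorem rowLattice_mem_boundedLattices {e R : ℕ} {C : Matrix (Fin e) (Fin q) ℤ}
    (h : ∀ i j, |C i j| ≤ R) : rowLattice C ∈ boundedLattices q R := by
  refine ⟨_, ?_, rfl⟩
  rintro _ ⟨i, rfl⟩
  exact ⟨fun j => (abs_le.1 (h i j)).1, fun j => (abs_le.1 (h i j)).2⟩

/-- The number of lattices with bounded generators strictly inside the given one. -/
def latticeRank (R : ℕ) (L : Submodule ℤ (Fin q → ℤ)) : ℕ :=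
  (boundedLattices q R ∩ Set.Iio L).ncard

/-- `L'` is counted for `L` but not for itself. Nothing bounds `L`, so the lattice of the initial
identity matrix needs no special treatment. -/
theorem latticeRank_lt {R : ℕ} {L L' : Submodule ℤ (Fin q → ℤ)} (h : L' < L)
    (hL' : L' ∈ boundedLattices q R) : latticeRank R L' < latticeRank R L := by
  refine Set.ncard_lt_ncard ⟨fun x hx => ⟨hx.1, hx.2.trans h⟩, fun hsub => ?_⟩
    ((finite_boundedLattices q R).subset Set.inter_subset_left)
  exact lt_irrefl L' (hsub ⟨hL', h⟩).2

end Lattice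

/-! ### Accessibility of the states -/

section Accessibility

variable {f g : ℤ[X]} [Fact (Irreducible (overQ f))] {b : ℝ}

/-- No infinite run starts in the state. -/
abbrev Terminates (f g : ℤ[X]) [Fact (Irreducible (overQ f))] (b : ℝ) (s : State f) : Prop :=
  Acc (fun s' s => Step f g b s s') s

theorem terminates_halt (o : Output f) : Terminates f g b (.halt o) :=
  ⟨_, fun _ h => nomatch h⟩

/-- A bad prime is at most `M`, so it lowers `M - p`; a good prime with a single degree lowers `25 -
k` and does not raise `M - p`. -/
theorem terminates_search {M : ℕ} (hM : ∀ p : ℕ, p.Prime → ¬ IsGoodPrime f g p → p ≤ M)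
    {c e : ℕ} {C : Matrix (Fin e) (Fin (f.natDegree + 1)) ℤ}
    (hfound : ∀ p, p.Prime → Terminates f g b (.found p c e C)) (p k : ℕ) :
    Terminates f g b (.search p k c e C) := by
  induction h : (M - p) + (25 - k) using Nat.strong_induction_on generalizing p k with
  | _ x ih =>
    subst h
    refine ⟨_, fun s' hs => ?_⟩
    cases hs with
    | bad hp hbad =>
      have h1 := hM _ hp.1.1 hbad
      have h2 := hp.1.2
      exact ih _ (by omega) _ _ rfl
    | single hp hgood hm hk =>
      have h2 := hp.1.2
      exact ih _ (by omega) _ _ rfl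
    | galois => exact terminates_halt _
    | mismatch => exact terminates_halt _
    | suitable hp => exact hfound _ hp.1.1

theorem terminates_reduce {p c m : ℕ} {M : Submodule ℤ (Fin (f.natDegree + 1) ⊕ Fin m → ℤ)}
    (hdone : ∀ (e : ℕ) (A : Matrix (Fin e) (Fin (f.natDegree + 1) ⊕ Fin m) ℤ),
      RowsIndependent A → (∀ i, A i ∈ M) → (¬ ∃ A', LLLMove b ⟨e, A⟩ A') →
        Terminates f g b (.returned p c m e A.toCols₁ A.toCols₂))
    (A : Rows (Fin (f.natDegree + 1) ⊕ Fin m)) (hA : RowsIndependent A.2)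
    (hAM : ∀ i, A.2 i ∈ M) : Terminates f g b (.reduce p c m A) := by
  induction acc_lllMove b A hA with
  | intro A _ ih =>
    refine ⟨_, fun s' hs => ?_⟩
    cases hs with
    | move h => exact ih _ h (h.rowsIndependent hA) (h.row_mem hAM)
    | done h => exact hdone _ _ hA hAM h

/-- Multiples of `(10 ^ 20) ^ k` that are smaller than `(10 ^ 20) ^ K` in absolute value vanish once
`K ≤ k`; so `K - k` is a measure for the rescaling loop. -/
theorem terminates_returned {p c m K : ℕ}
    {Λ : Submodule ℤ (Fin (f.natDegree + 1) ⊕ Fin m → ℤ)}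
    (hK : ((f.natDegree + 1 + m : ℕ) : ℝ) * (2 ^ (f.natDegree + 1 + m) * |b|) < (10 ^ 20) ^ K)
    (hnext : ∀ (t : ℤ) (e : ℕ) (A : Matrix (Fin e) (Fin (f.natDegree + 1) ⊕ Fin m) ℤ),
      t ≠ 0 → RowsIndependent A → (∀ i, A i ∈ Λ.map (scaleRight _ m t)) →
        (¬ ∃ A', LLLMove b ⟨e, A⟩ A') → A.toCols₂ = 0 →
          Terminates f g b (.search p 0 c e A.toCols₁))
    (k e : ℕ) (A : Matrix (Fin e) (Fin (f.natDegree + 1) ⊕ Fin m) ℤ) (hA : RowsIndependent A)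
    (hAΛ : ∀ i, A i ∈ Λ.map (scaleRight _ m ((10 ^ 20) ^ k)))
    (hterm : ¬ ∃ A', LLLMove b ⟨e, A⟩ A') :
    Terminates f g b (.returned p c m e A.toCols₁ A.toCols₂) := by
  induction h : K - k using Nat.strong_induction_on generalizing k e A with
  | _ x ih =>
    subst h
    generalize hCe : A.toCols₁ = C
    generalize hBe : A.toCols₂ = B
    refine ⟨_, fun s' hs => ?_⟩
    cases hs with
    | rescale hB =>
      have hk : k < K := by
        by_contra hk
        refine hB (Matrix.ext fun i j => ?_)
        obtain ⟨u, -, hu⟩ := hAΛ i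
        have h1 : (10 ^ 20) ^ k * u (Sum.inr j) = A i (Sum.inr j) := congrFun hu (Sum.inr j)
        have h2 := (abs_entry_le_of_rowsIndependent_of_terminal hA hterm
          (N := f.natDegree + 1 + m) (by simp) i (Sum.inr j)).trans_lt hK
        have h3 : |A i (Sum.inr j)| < (10 ^ 20) ^ k := by
          have h4 : |A i (Sum.inr j)| < (10 ^ 20) ^ K := by exact_mod_cast h2
          exact h4.trans_le (pow_le_pow_right₀ (by norm_num) (not_lt.1 hk))
        rw [← hBe]
        exact Int.eq_zero_of_abs_lt_dvd (Dvd.intro _ h1) h3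
      rw [← hCe, ← hBe]
      have hmem : ∀ i, Matrix.fromCols A.toCols₁ ((10 ^ 20 : ℤ) • A.toCols₂) i ∈
          Λ.map (scaleRight _ m ((10 ^ 20) ^ (k + 1))) := by
        intro i
        obtain ⟨u, hu, hui⟩ := hAΛ i
        exact ⟨u, hu, by rw [rescale_row, ← hui, scaleRight_scaleRight, pow_succ']⟩
      exact terminates_reduce
        (fun e' A' hA' hAΛ' hterm' => ih _ (by omega) (k + 1) e' A' hA' hAΛ' hterm' rfl) _
        (rowsIndependent_rescale hA (by norm_num)) hmem
    | empty => exact terminates_halt _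
    | unique => exact terminates_halt _
    | failed => exact terminates_halt _
    | again hB he =>
      rw [← hCe]
      exact hnext _ e A (by positivity) hA hAΛ hterm (hBe.trans hB)

theorem terminates_reduce_bigMatrix {p c e m R : ℕ}
    (hR : ((f.natDegree + 1 : ℕ) : ℝ) * (2 ^ (f.natDegree + 1) * |b|) ≤ R)
    {C : Matrix (Fin e) (Fin (f.natDegree + 1)) ℤ} (hC : RowsIndependent C)
    {T : Matrix (Fin (f.natDegree + 1)) (Fin m) ℤ} {N : ℤ} (hN : N ≠ 0)
    (h0 : ¬ ∀ i j, N ∣ (C * T) i j)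
    (hnext : ∀ (e' : ℕ) (C' : Matrix (Fin e') (Fin (f.natDegree + 1)) ℤ), RowsIndependent C' →
      rowLattice C' < rowLattice C → rowLattice C' ∈ boundedLattices (f.natDegree + 1) R →
        Terminates f g b (.search p 0 c e' C')) :
    Terminates f g b (.reduce p c m ⟨e + m, bigMatrix C T N⟩) := by
  -- `K` may depend on `m`, hence on the prime, as it serves this rescaling loop only; `R` must not.
  obtain ⟨K, hK⟩ := pow_unbounded_of_one_lt
    (((f.natDegree + 1 + m : ℕ) : ℝ) * (2 ^ (f.natDegree + 1 + m) * |b|))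
    (show (1 : ℝ) < 10 ^ 20 by norm_num)
  have hmem : ∀ i, bigMatrix C T N i ∈
      (traceLattice (rowLattice C) T N).map (scaleRight _ m ((10 ^ 20) ^ 0)) := fun i => by
    rw [pow_zero]
    exact ⟨_, bigMatrix_row_mem C T N i, scaleRight_one _⟩
  refine terminates_reduce (fun e' A hA hAΛ hterm => terminates_returned hK
    (fun t e' A ht hA hAΛ hterm hB => ?_) 0 e' A hA hAΛ hterm) _
    (rowsIndependent_bigMatrix hC T hN) hmem
  have hC' := rowsIndependent_toCols₁ hA hB
  refine hnext _ _ hC' (rowLattice_toCols₁_lt ht h0 hAΛ hB)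
    (rowLattice_mem_boundedLattices fun i j => ?_)
  -- With `B = 0` the rows of `C` are independent by themselves, so their number, and with it the
  -- bound `R`, does not involve `m`.
  have he' : e' ≤ f.natDegree + 1 := by simpa using hC'.card_le
  have h1 : (|A i (Sum.inl j)| : ℝ) ≤ R := by
    refine (abs_entry_le_of_terminal hterm i (Sum.inl j)).trans (le_trans ?_ hR)
    gcongr
    norm_num
  exact_mod_cast h1

/-- Lexicographic induction: an LLL call lowers the lattice rank; an idle pass keeps the lattice and
lowers `10 - c`. -/
theorem terminates_search_of_rowsIndependent {M : ℕ}
    (hM : ∀ p : ℕ, p.Prime → ¬ IsGoodPrime f g p → p ≤ M) {c e : ℕ}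
    {C : Matrix (Fin e) (Fin (f.natDegree + 1)) ℤ} (hC : RowsIndependent C) (p k : ℕ) :
    Terminates f g b (.search p k c e C) := by
  obtain ⟨R, hR⟩ := exists_nat_ge
    (((f.natDegree + 1 : ℕ) : ℝ) * (2 ^ (f.natDegree + 1) * |b|))
  induction hr : latticeRank R (rowLattice C) using Nat.strong_induction_on
    generalizing c e C p k with
  | _ r ihr =>
  induction hd : 10 - c using Nat.strong_induction_on generalizing c p k with
  | _ d ihd =>
  subst hr hd
  refine terminates_search hM (fun p hp => ⟨_, fun s' hs => ?_⟩) p k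
  cases hs with
  | idle T hT h0 hc => exact ihd _ (by omega) _ _ rfl
  | giveUp => exact terminates_halt _
  | call T hT h0 =>
    exact terminates_reduce_bigMatrix hR hC (pow_ne_zero _ (Nat.cast_ne_zero.2 hp.ne_zero)) h0
      fun e' C' hC' hlt hmem => ihr _ (latticeRank_lt hlt hmem) hC' p 0 rfl

end Accessibility

/-! ### Nonzero discriminants and the finiteness of the set of bad primes. -/

section Discriminant

theorem natDegree_pos_of_irreducible {f : ℤ[X]} (hf : Irreducible (overQ f)) :
    0 < f.natDegree := by
  have h := hf.natDegree_pos
  rwa [natDegree_map_eq_of_injective (RingHom.injective_int _)] at h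

/-- Up to sign, leading coefficient times discriminant is the resultant of `f` and `f'`, which are
coprime over `ℚ` by separability. -/
theorem discr_ne_zero_of_irreducible {f : ℤ[X]} (hf : Irreducible (overQ f)) : f.discr ≠ 0 := by
  intro h
  have h1 := resultant_deriv (natDegree_pos_iff_degree_pos.1 (natDegree_pos_of_irreducible hf))
  rw [h, mul_zero] at h1
  have h2 := resultant_map_map f (derivative f) f.natDegree (f.natDegree - 1) (Int.castRingHom ℚ)
  have h3 : (overQ f).natDegree = f.natDegree :=
    natDegree_map_eq_of_injective (RingHom.injective_int _) f
  -- The formal degree `n - 1` is the true degree of the derivative in characteristic zero, so the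
  -- resultant criterion applies.
  rw [h1, map_zero, ← derivative_map, ← h3, ← natDegree_derivative] at h2
  exact (resultant_eq_zero_iff.1 h2).2 hf.separable

theorem exists_forall_bad_prime_le {f g : ℤ[X]} (hf : Irreducible (overQ f))
    (hg : Irreducible (overQ g)) :
    ∃ M : ℕ, ∀ p : ℕ, p.Prime → ¬ IsGoodPrime f g p → p ≤ M := by
  have hlc : ∀ {h : ℤ[X]}, Irreducible (overQ h) → h.leadingCoeff ≠ 0 := fun hh =>
    leadingCoeff_ne_zero.2 (ne_zero_of_natDegree_gt (natDegree_pos_of_irreducible hh))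
  have hne : f.discr * f.leadingCoeff * g.discr * g.leadingCoeff ≠ 0 :=
    mul_ne_zero (mul_ne_zero (mul_ne_zero (discr_ne_zero_of_irreducible hf) (hlc hf))
      (discr_ne_zero_of_irreducible hg)) (hlc hg)
  refine ⟨_, fun p _ hbad => Nat.le_of_dvd (Int.natAbs_pos.2 hne) (Int.natCast_dvd.1 ?_)⟩
  by_contra hdvd
  exact hbad ⟨fun h => hdvd (((h.mul_right _).mul_right _).mul_right _),
    fun h => hdvd (((h.mul_left _).mul_right _).mul_right _),
    fun h => hdvd ((h.mul_left _).mul_right _), fun h => hdvd (h.mul_left _)⟩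

end Discriminant

/-! ### Integrality of sub-traces at good primes. -/

section SubTrace

variable (p : ℕ) [Fact p.Prime]

/-- A Galois-fixed element lies in `ℚ_[p]`; being integral, it lies in `ℤ_[p]`, where it is
approximated modulo `p ^ a` by a natural number. -/
theorem exists_represents {x : AlgebraicClosure ℚ_[p]} (hint : IsIntegral ℤ_[p] x)
    (hfix : ∀ σ : Gal(AlgebraicClosure ℚ_[p]/ℚ_[p]), σ x = x) (a : ℕ) :
    ∃ t : ℤ, Represents p a t x := by
  obtain ⟨y, rfl⟩ := (InfiniteGalois.mem_range_algebraMap_iff_fixed x).2 hfix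
  rw [isIntegral_algebraMap_iff (algebraMap ℚ_[p] (AlgebraicClosure ℚ_[p])).injective] at hint
  obtain ⟨z, rfl⟩ := IsIntegrallyClosed.isIntegral_iff.1 hint
  obtain ⟨w, hw⟩ := Ideal.mem_span_singleton.1 (PadicInt.appr_spec a z)
  refine ⟨z.appr a, w, congrArg _ ?_⟩
  have h : z = (z.appr a : ℤ_[p]) + (p : ℤ_[p]) ^ a * w := by rw [← hw]; ring
  have h' := congrArg (fun y : ℤ_[p] => (y : ℚ_[p])) h
  push_cast at h' ⊢
  exact h'

theorem isUnit_intCast_of_not_dvd {a : ℤ} (h : ¬ (p : ℤ) ∣ a) : IsUnit (a : ℤ_[p]) := by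
  rw [PadicInt.isUnit_iff]
  exact le_antisymm (PadicInt.norm_le_one _)
    (not_lt.1 fun h' => h ((PadicInt.norm_int_lt_one_iff_dvd a).1 h'))

variable {p}

theorem isIntegral_of_isUnit_mul {K : Type*} [CommRing K] [Algebra ℤ_[p] K] {u : ℤ_[p]} {x : K}
    (hu : IsUnit u) (h : IsIntegral ℤ_[p] (u • x)) : IsIntegral ℤ_[p] x := by
  obtain ⟨v, rfl⟩ := hu
  have := h.smul (↑v⁻¹ : ℤ_[p])
  rwa [smul_smul, Units.inv_mul, one_smul] at this

variable {K : Type*} [Field K] [Algebra ℤ_[p] K]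

/-- Leading coefficient times root is integral over `ℤ`, and the leading coefficient is a `p`-adic
unit. -/
theorem isIntegral_of_isRoot {f : ℤ[X]} (hlc : ¬ (p : ℤ) ∣ f.leadingCoeff) {γ : K}
    (hγ : eval₂ (Int.castRingHom K) γ f = 0) : IsIntegral ℤ_[p] γ := by
  have h1 : IsIntegral ℤ (f.leadingCoeff • γ) := isIntegral_leadingCoeff_smul f γ hγ
  refine isIntegral_of_isUnit_mul (isUnit_intCast_of_not_dvd p hlc) ?_
  rw [Int.cast_smul_eq_zsmul]
  exact h1.tower_top

theorem isIntegral_aeval {γ : K} (hγ : IsIntegral ℤ_[p] γ) (Q : ℤ[X]) :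
    IsIntegral ℤ_[p] (aeval γ Q) := by
  rw [aeval_eq_sum_range]
  exact IsIntegral.sum _ fun i _ => by
    rw [← Int.cast_smul_eq_zsmul ℤ_[p]]
    exact (hγ.pow i).smul _

/-- Evaluating the Bézout identity of the resultant at `γ` gives `f'(γ) Q(γ) = ± f_n disc(f)`, a
`p`-adic unit; so the inverse is `Q(γ)` up to a unit. -/
theorem isIntegral_inv_eval₂_derivative {f : ℤ[X]} (hdeg : 0 < f.natDegree)
    (hlc : ¬ (p : ℤ) ∣ f.leadingCoeff) (hdisc : ¬ (p : ℤ) ∣ f.discr) {γ : K}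
    (hγ : eval₂ (Int.castRingHom K) γ f = 0) :
    IsIntegral ℤ_[p] (eval₂ (Int.castRingHom K) γ (derivative f))⁻¹ := by
  change IsIntegral ℤ_[p] (aeval γ (derivative f))⁻¹
  change aeval γ f = 0 at hγ
  obtain ⟨P, Q, -, -, h⟩ := exists_mul_add_mul_eq_C_resultant f (derivative f) le_rfl
    (natDegree_derivative_le f) (Or.inl hdeg.ne')
  rw [resultant_deriv (natDegree_pos_iff_degree_pos.1 hdeg)] at h
  set ρ := (-1) ^ (f.natDegree * (f.natDegree - 1) / 2) * f.leadingCoeff * f.discr with hρ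
  have hunit : IsUnit ((ρ : ℤ) : ℤ_[p]) := by
    rw [hρ]
    push_cast
    exact ((isUnit_one.neg.pow _).mul (isUnit_intCast_of_not_dvd p hlc)).mul
      (isUnit_intCast_of_not_dvd p hdisc)
  have h1 : aeval γ (derivative f) * aeval γ Q = algebraMap ℤ_[p] K ρ := by
    have h2 := congrArg (aeval γ) h
    rw [map_add, map_mul, map_mul, hγ, zero_mul, zero_add, aeval_C] at h2
    rw [h2]
    simp
  have hne : aeval γ (derivative f) ≠ 0 := by
    intro h0
    rw [h0, zero_mul] at h1
    exact (hunit.map (algebraMap ℤ_[p] K)).ne_zero h1.symm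
  refine isIntegral_of_isUnit_mul hunit ?_
  rw [Algebra.smul_def, ← h1, mul_comm (aeval γ (derivative f)), mul_assoc, mul_inv_cancel₀ hne,
    mul_one]
  exact isIntegral_aeval (isIntegral_of_isRoot hlc hγ) Q

theorem aeval_representative (f : ℤ[X]) {L : Type*} [Field L] [Algebra ℚ_[p] L]
    (φ : RootField f →+* L) (x : RootField f) :
    aeval (φ (rootOf f)) ((representative f x).map (algebraMap ℚ ℚ_[p])) = φ x := by
  have h1 : AdjoinRoot.mk (overQ f) (representative f x) = x := by
    conv_rhs => rw [← Function.surjInv_eq AdjoinRoot.mk_surjective x]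
    rw [representative, AdjoinRoot.mk_eq_mk]
    exact ⟨-(Function.surjInv AdjoinRoot.mk_surjective x / overQ f), by
      rw [← sub_eq_iff_eq_add'.2 (EuclideanDomain.div_add_mod
        (Function.surjInv AdjoinRoot.mk_surjective x) (overQ f)).symm]
      ring⟩
  conv_rhs => rw [← h1]
  rw [aeval_def, eval₂_map, ← AdjoinRoot.aeval_eq, aeval_def, hom_eval₂]
  exact congrArg (fun ψ : ℚ →+* L => eval₂ ψ _ _) (Subsingleton.elim _ _)

theorem degreeFactor_dvd {k : Type} [Field k] {F : k[X]} (hF : F ≠ 0) (d : ℕ) :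
    degreeFactor F d ∣ F := by
  classical
  exact (Multiset.prod_dvd_prod_of_le (Multiset.filter_le _ _)).trans
    (UniqueFactorizationMonoid.prod_normalizedFactors hF).dvd

theorem eval₂_apply_rootOf {f : ℤ[X]} {L : Type*} [Field L] (φ : RootField f →+* L) (h : ℤ[X]) :
    φ (aeval (rootOf f) h) = eval₂ (Int.castRingHom L) (φ (rootOf f)) h := by
  rw [aeval_def, hom_eval₂]
  exact congrArg (fun ψ : ℤ →+* L => eval₂ ψ _ _) (Subsingleton.elim _ _)

theorem eval₂_apply_rootOf_self {f : ℤ[X]} {L : Type*} [Field L] (φ : RootField f →+* L) :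
    eval₂ (Int.castRingHom L) (φ (rootOf f)) f = 0 := by
  have h1 : eval₂ (AdjoinRoot.of (overQ f)) (rootOf f) (overQ f) = 0 := AdjoinRoot.eval₂_root _
  rw [← eval₂_apply_rootOf, ← map_zero φ, ← h1, eval₂_map, aeval_def]
  exact congrArg (fun ψ : ℤ →+* RootField f => φ (eval₂ ψ _ _)) (Subsingleton.elim _ _)

/-- A sub-trace is represented by an integer if all summands are integral. -/
theorem exists_represents_subTrace {f : ℤ[X]} (hf0 : f ≠ 0) (x : RootField f)
    (hx : ∀ φ : RootField f →+* AlgebraicClosure ℚ_[p], IsIntegral ℤ_[p] (φ x)) (d a : ℕ) :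
    ∃ t : ℤ, Represents p a t (subTrace f p d x) := by
  classical
  refine exists_represents p (IsIntegral.sum _ fun γ hγ => ?_) (fun σ => ?_) a
  · have hroot := (mem_aroots'.1 (Multiset.mem_toFinset.1 hγ)).2
    have hF : f.map (Int.castRingHom ℚ_[p]) ≠ 0 :=
      (Polynomial.map_ne_zero_iff (RingHom.injective_int _)).2 hf0
    -- A root `γ` of the degree factor is a root of `f`, so it defines an embedding of `ℚ(α)`, and
    -- the summand is the image of `x`.
    have h1 : eval₂ (algebraMap ℚ _) γ (overQ f) = 0 := by
      have h2 := aeval_eq_zero_of_dvd_aeval_eq_zero (degreeFactor_dvd hF d) hroot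
      rw [aeval_def, eval₂_map] at h2
      rw [eval₂_map, ← h2]
      exact congrArg (fun ψ : ℤ →+* _ => eval₂ ψ _ _) (Subsingleton.elim _ _)
    have h2 := aeval_representative f (AdjoinRoot.lift (algebraMap ℚ _) γ h1) x (p := p)
    rw [AdjoinRoot.lift_root] at h2
    rw [h2]
    exact hx _
  -- An automorphism permutes the roots of the degree factor, whose coefficients lie in `ℚ_[p]`.
  · rw [map_sum]
    refine Finset.sum_bij' (fun γ _ => σ γ) (fun γ _ => σ.symm γ) ?_ ?_ (fun γ _ => ?_)
      (fun γ _ => ?_) (fun γ _ => ?_)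
    · intro γ hγ
      obtain ⟨h1, h2⟩ := mem_aroots.1 (Multiset.mem_toFinset.1 hγ)
      refine Multiset.mem_toFinset.2 (mem_aroots.2 ⟨h1, ?_⟩)
      rw [aeval_algHom_apply, h2, map_zero]
    · intro γ hγ
      obtain ⟨h1, h2⟩ := mem_aroots.1 (Multiset.mem_toFinset.1 hγ)
      refine Multiset.mem_toFinset.2 (mem_aroots.2 ⟨h1, ?_⟩)
      rw [aeval_algHom_apply, h2, map_zero]
    · exact σ.symm_apply_apply γ
    · exact σ.apply_symm_apply γ
    · exact (aeval_algHom_apply ..).symm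

theorem exists_isTraceMatrix {f g : ℤ[X]} [Fact (Irreducible (overQ f))]
    (hg : Irreducible (overQ g)) (hgood : IsGoodPrime f g p) (a : ℕ) :
    ∃ T, IsTraceMatrix f g p a T := by
  have hf : Irreducible (overQ f) := Fact.out
  have hbase : ∀ d i, ∃ t : ℤ, Represents p a t (subTrace f p d (base f i)) := fun d i => by
    refine exists_represents_subTrace
      (ne_zero_of_natDegree_gt (natDegree_pos_of_irreducible hf)) _ (fun φ => ?_) d a
    rw [base, map_div₀, map_pow, eval₂_apply_rootOf, div_eq_mul_inv]
    have hγ := eval₂_apply_rootOf_self φ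
    exact ((isIntegral_of_isRoot hgood.2.1 hγ).pow i).mul
      (isIntegral_inv_eval₂_derivative (natDegree_pos_of_irreducible hf) hgood.2.1 hgood.1 hγ)
  have hroot : ∀ d, ∃ t : ℤ, Represents p a t (subTrace g p d (rootOf g)) := fun d =>
    exists_represents_subTrace (ne_zero_of_natDegree_gt (natDegree_pos_of_irreducible hg)) _
      (fun φ => isIntegral_of_isRoot hgood.2.2.2 (eval₂_apply_rootOf_self φ)) d a
  choose t ht using hbase
  choose u hu using hroot
  refine ⟨Matrix.of (Fin.lastCases (fun j => u (degreeAt f p j))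
    fun i j => t (degreeAt f p j) i), fun j => ⟨fun i => ?_, ?_⟩⟩
  · rw [Matrix.of_apply, Fin.lastCases_castSucc]
    exact ht _ _
  · rw [Matrix.of_apply, Fin.lastCases_last]
    exact hu _

end SubTrace

/-! ### No reachable state is stuck. -/

section Progress

variable {f g : ℤ[X]} [Fact (Irreducible (overQ f))] {b : ℝ}

/-- In the states in which a suitable prime has been found, the prime is a good prime. -/
def HasGoodPrime (f g : ℤ[X]) : State f → Prop
  | .found p _ _ _ => p.Prime ∧ IsGoodPrime f g p
  | _ => True

/-- A found state does not record that its prime is good, yet `T` is only known to exist for good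
primes. Every step establishes this in its target, whatever its source. -/
theorem Step.hasGoodPrime {s s' : State f} (h : Step f g b s s') : HasGoodPrime f g s' := by
  cases h with
  | suitable hp hgood => exact ⟨hp.1.1, hgood⟩
  | _ => trivial

theorem exists_isNextPrime (p₀ : ℕ) : ∃ p, IsNextPrime p₀ p := by
  have hne : {r : ℕ | r.Prime ∧ p₀ < r}.Nonempty := by
    obtain ⟨r, hr, hr'⟩ := Nat.exists_infinite_primes (p₀ + 1)
    exact ⟨r, hr', hr⟩
  exact ⟨_, Nat.sInf_mem hne, fun _ h => Nat.sInf_le h⟩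

theorem exists_step_or_halt (hg : Irreducible (overQ g)) {s : State f}
    (hs : HasGoodPrime f g s) : (∃ s', Step f g b s s') ∨ ∃ o, s = .halt o := by
  cases s with
  | halt o => exact Or.inr ⟨o, rfl⟩
  | search p₀ k c e C =>
    refine Or.inl ?_
    obtain ⟨p, hp⟩ := exists_isNextPrime p₀
    have : Fact p.Prime := ⟨hp.1.1⟩
    by_cases hgood : IsGoodPrime f g p
    · by_cases hm : numDegrees f p = 1
      · rcases le_or_gt (k + 1) 25 with hk | hk
        · exact ⟨_, .single hp hgood hm hk⟩
        · exact ⟨_, .galois hp hgood hm hk⟩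
      · by_cases hsh : SameShape f g p
        · exact ⟨_, .suitable hp hgood hm hsh⟩
        · exact ⟨_, .mismatch hp hgood hm hsh⟩
    · exact ⟨_, .bad hp hgood⟩
  | found p c e C =>
    refine Or.inl ?_
    have : Fact p.Prime := ⟨hs.1⟩
    obtain ⟨T, hT⟩ := exists_isTraceMatrix (f := f) hg hs.2 (precision b e)
    by_cases h0 : ∀ i j, (p : ℤ) ^ precision b e ∣ (C * T) i j
    · rcases lt_or_ge (c + 1) 10 with hc | hc
      · exact ⟨_, .idle T hT h0 hc⟩
      · exact ⟨_, .giveUp T hT h0 hc⟩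
    · exact ⟨_, .call T hT h0⟩
  | reduce p c m A =>
    refine Or.inl ?_
    by_cases h : ∃ A', LLLMove b A A'
    · obtain ⟨A', h⟩ := h
      exact ⟨_, .move h⟩
    · exact ⟨_, .done h⟩
  | returned p c m e C B =>
    refine Or.inl ?_
    by_cases hB : B = 0
    · match e, C, B, hB with
      | 0, C, B, hB => exact ⟨_, .empty hB⟩
      | 1, C, B, hB =>
        by_cases h : C 0 (Fin.last _) ≠ 0 ∧ aeval (candidate f g (C 0)) g = 0
        · exact ⟨_, .unique hB h⟩
        · exact ⟨_, .failed hB h⟩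
      | e + 2, C, B, hB => exact ⟨_, .again hB (Nat.le_add_left 2 e)⟩
    · exact ⟨_, .rescale hB⟩

end Progress

end NumberFieldIso

end

theorem mainTheorem8 (f g : Polynomial ℤ)
    [Fact (Irreducible (f.map (Int.castRingHom ℚ)))]
    [Fact (Irreducible (g.map (Int.castRingHom ℚ)))]
    (hdeg : f.natDegree = g.natDegree)
    (S : ℝ) (hS : NumberFieldIso.rootSum g ≤ S) :
    (¬ ∃ run : ℕ → NumberFieldIso.State f,
      run 0 = NumberFieldIso.start f ∧
        ∀ i, NumberFieldIso.Step f g (NumberFieldIso.lengthBound f S) (run i) (run (i + 1))) ∧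
    (∀ s : NumberFieldIso.State f,
      Relation.ReflTransGen (NumberFieldIso.Step f g (NumberFieldIso.lengthBound f S))
        (NumberFieldIso.start f) s →
      (∃ s', NumberFieldIso.Step f g (NumberFieldIso.lengthBound f S) s s') ∨
        ∃ o, s = NumberFieldIso.State.halt o) := by
  have hf : Irreducible (NumberFieldIso.overQ f) := Fact.out
  have hg : Irreducible (NumberFieldIso.overQ g) := Fact.out
  obtain ⟨M, hM⟩ := NumberFieldIso.exists_forall_bad_prime_le hf hg
  refine ⟨?_, fun s hs => NumberFieldIso.exists_step_or_halt hg ?_⟩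
  · rintro ⟨run, h0, hrun⟩
    have hacc : NumberFieldIso.Terminates f g (NumberFieldIso.lengthBound f S) (run 0) :=
      h0 ▸ NumberFieldIso.terminates_search_of_rowsIndependent hM
        (NumberFieldIso.rowsIndependent_one _) 3 0
    generalize hi : run 0 = s at hacc
    -- Accessibility induction needs the claim at every index, since the next state of the run sits
    -- at `i + 1`.
    suffices ∀ i, run i ≠ s from this 0 hi
    clear hi
    induction hacc with
    | intro s _ ih =>
      intro i hi
      exact ih _ (hi ▸ hrun i) (i + 1) rfl
  · rcases Relation.ReflTransGen.cases_tail hs with rfl | ⟨s', -, hstep⟩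
    · trivial
    · exact hstep.hasGoodPrime
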